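/- Let $R$ be a field of characteristic $0$ (for instance $\mathbb R$, $\mathbb C$ or a field of rational functions over them), let $n\ge 1$, and let ${\bf w}=(w_k)_{k\ge 2}$ be weights in $R$. Let $\overline{\mathcal K}_n$ be the complete hypergraph on $n$ labelled vertices, whose hyperedges are all the vertex subsets of cardinality at least $2$. A spanning hyperforest of $\overline{\mathcal K}_n$ is a set $F$ of hyperedges containing no cycle, where a cycle is a closed walk $(v_0,e_1,v_1,\dots,e_k,v_k=v_0)$ with $k\ge 2$, $v_{i-1},v_i\in e_i\in F$, distinct vertices $v_0,\dots,v_{k-1}$ and distinct hyperedges $e_1,\dots,e_k$. Its weight is $\prod_{A\in F}w_{|A|}$, and $c(F)$ is its number of connected components (isolated vertices included). A hypertree is a connected hyperforest. A rooted hyperforest is a hyperforest with one vertex (root) chosen in each component. Let $$F_n(\lambda;{\bf w})=\sum_{F}\lambda^{c(F)}\prod_{A\in F}w_{|A|}$$ be the generating function of unrooted spanning hyperforests of $\overline{\mathcal K}_n$. Let $u_{n,p}$ and $t_{n,p}$ be the total weights of unrooted, respectively rooted, spanning hyperforests with exactly $p$ components, and let $u_n$ be the total weight of unrooted spanning hypertrees.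 Define polynomials $P_s(x;{\bf w})$ in $x$, polynomials $\Pi_s(\lambda;{\bf w})$ in $\lambda$ and coefficients $\pi_{s,p}({\bf w})$ by the formal power series identities $$\exp\Big[x\sum_{k\ge2}w_k\frac{y^{k-1}}{(k-1)!}\Big]=\sum_{s\ge0}P_s(x;{\bf w})\frac{y^s}{s!},$$ $$\exp\Big[\lambda\Big(y+\sum_{k\ge2}w_k(1-k)\frac{y^k}{k!}\Big)\Big]=\sum_{s\ge0}\Pi_s(\lambda;{\bf w})\frac{y^s}{s!}=\sum_{s\ge0}\sum_{p\ge0}\pi_{s,p}({\bf w})\lambda^p\frac{y^s}{s!}.$$ Then for every $\lambda\in R$ $$F_n(\lambda;{\bf w})=\sum_{p=0}^n u_{n,p}\lambda^p=\sum_{s=1}^n\Pi_s(\lambda;{\bf w})\,t_{n,s}=\sum_{s=1}^n\binom{n-1}{s-1}\Pi_s(\lambda;{\bf w})\,P_{n-s}(n;{\bf w}).$$ For every $p\ge0$ $$u_{n,p}=\sum_{s=1}^n\pi_{s,p}({\bf w})\,t_{n,s}=\sum_{s=1}^n\binom{n-1}{s-1}\pi_{s,p}({\bf w})\,P_{n-s}(n;{\bf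 w}).$$ In particular $$u_n=u_{n,1}=\frac{P_{n-1}(n;{\bf w})}{n}=\frac{t_{n,1}}{n}.$$ -/

import Mathlib

namespace Hyperforest

section Combinatorics

variable {V : Type*}

/-- Two vertices lie in a common hyperedge of the edge set `F`. -/
def Linked (F : Finset (Finset V)) (u v : V) : Prop :=
  ∃ A ∈ F, u ∈ A ∧ v ∈ A

/-- `u` is connected to `v` by a walk `u = v₀, e₁, v₁, …, eₖ, vₖ = v` (with `k ≥ 0`,
all `eᵢ ∈ F`, and `vᵢ₋₁, vᵢ ∈ eᵢ`). -/
def Joined (F : Finset (Finset V)) : V → V → Prop :=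
  Relation.ReflTransGen (Linked F)

theorem Joined.symm {F : Finset (Finset V)} {u v : V} (h : Joined F u v) : Joined F v u := by
  induction h with
  | refl => exact Relation.ReflTransGen.refl
  | tail _ hbc ih =>
    obtain ⟨A, hA, hb, hc⟩ := hbc
    exact Relation.ReflTransGen.head ⟨A, hA, hc, hb⟩ ih

/-- Being connected by a walk, as an equivalence relation on all the vertices. -/
def joinedSetoid (F : Finset (Finset V)) : Setoid V where
  r := Joined F
  iseqv := ⟨fun _ => Relation.ReflTransGen.refl, fun h => h.symm, fun h h' => h.trans h'⟩

/-- The number of connected components of the spanning subhypergraph `(V, F)`;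
isolated vertices are components. -/
noncomputable def numComponents (F : Finset (Finset V)) : ℕ :=
  Nat.card (Quotient (joinedSetoid F))

/-- A cycle of length `k ≥ 2` in `(V, F)`: a closed walk
`v 0, e 0, v 1, e 1, …, e (k - 1), v k = v 0` in which `v 0, …, v (k - 1)` are distinct
vertices and `e 0, …, e (k - 1)` are distinct hyperedges. Only these values matter. -/
def IsCycle (F : Finset (Finset V)) (k : ℕ) (v : ℕ → V) (e : ℕ → Finset V) : Prop :=
  2 ≤ k ∧ (∀ i < k, e i ∈ F ∧ v i ∈ e i ∧ v (i + 1) ∈ e i) ∧ v k = v 0 ∧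
    Set.InjOn v (Set.Iio k) ∧ Set.InjOn e (Set.Iio k)

/-- `(V, F)` contains no cycles. -/
def IsHyperforest (F : Finset (Finset V)) : Prop :=
  ∀ k v e, ¬ IsCycle F k v e

/-- `(V, F)` is a connected hyperforest. -/
def IsHypertree (F : Finset (Finset V)) : Prop :=
  IsHyperforest F ∧ ∀ u v, Joined F u v

/-- `S` is a choice of one root in each connected component of `(V, F)`. -/
def IsRootSet (F : Finset (Finset V)) (S : Finset V) : Prop :=
  ∀ v, ∃! r, r ∈ S ∧ Joined F v r

end Combinatorics

/-- The hyperedges of the complete hypergraph on `n` vertices: all subsets of the vertex set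
with at least two elements. A spanning subhypergraph is identified with its set of hyperedges. -/
def completeEdges (n : ℕ) : Finset (Finset (Fin n)) :=
  Finset.univ.filter fun A => 2 ≤ A.card

open Classical in
/-- The spanning hyperforests of the complete hypergraph on `n` vertices. -/
noncomputable def hyperforests (n : ℕ) : Finset (Finset (Finset (Fin n))) :=
  (completeEdges n).powerset.filter IsHyperforest

open Classical in
/-- The spanning hypertrees of the complete hypergraph on `n` vertices. -/
noncomputable def hypertrees (n : ℕ) : Finset (Finset (Finset (Fin n))) :=
  (completeEdges n).powerset.filter IsHypertree

section Weights

variable {R : Type*} [Field R]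

/-- The weight of a set of hyperedges when a hyperedge of cardinality `k` has weight `w k`. -/
def weight {V : Type*} (w : ℕ → R) (F : Finset (Finset V)) : R :=
  ∏ A ∈ F, w A.card

/-- The generating function `F_n(lam; w)` of unrooted spanning hyperforests, with weight `lam`
for each connected component. -/
noncomputable def unrootedGF (n : ℕ) (w : ℕ → R) (lam : R) : R :=
  ∑ F ∈ hyperforests n, weight w F * lam ^ numComponents F

/-- `u_{n,p}(w)`: the total weight of unrooted spanning hyperforests with `p` components. -/
noncomputable def unrootedWeight (n p : ℕ) (w : ℕ → R) : R :=
  ∑ F ∈ (hyperforests n).filter (fun F => numComponents F = p), weight w F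

/-- `u_n(w)`: the total weight of unrooted spanning hypertrees. -/
noncomputable def hypertreeWeight (n : ℕ) (w : ℕ → R) : R :=
  ∑ F ∈ hypertrees n, weight w F

open Classical in
/-- `t_{n,s}(w)`: the total weight of rooted spanning hyperforests with `s` components,
i.e. the sum over all such hyperforests and all choices of one root in each component. -/
noncomputable def rootedWeight (n s : ℕ) (w : ℕ → R) : R :=
  ∑ F ∈ (hyperforests n).filter (fun F => numComponents F = s),
    ∑ _S ∈ Finset.univ.filter (fun S : Finset (Fin n) => IsRootSet F S), weight w F

end Weights

section Polynomials

open PowerSeries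

variable {R : Type*} [Field R] [CharZero R]

/-- `exp(x g(y))` as a power series in `y` whose coefficients are polynomials in the
indeterminate `x`, for a power series `g` with zero constant term. -/
noncomputable def expMulIndet (g : PowerSeries R) : PowerSeries (Polynomial R) :=
  (PowerSeries.exp (Polynomial R)).subst
    (PowerSeries.C Polynomial.X * PowerSeries.map Polynomial.C g)

/-- The power series `∑_{k ≥ 2} w_k y^(k-1) / (k-1)!` in `y`. -/
noncomputable def thetaSeries (w : ℕ → R) : PowerSeries R :=
  PowerSeries.mk fun j => if 1 ≤ j then w (j + 1) / (j.factorial : R) else 0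

/-- The polynomials `P_s(x; w)`, given by
`exp[x ∑_{k ≥ 2} w_k y^(k-1) / (k-1)!] = ∑_s P_s(x; w) y^s / s!`. -/
noncomputable def polyP (s : ℕ) (w : ℕ → R) : Polynomial R :=
  (s.factorial : Polynomial R) * PowerSeries.coeff s (expMulIndet (thetaSeries w))

/-- The power series `y + ∑_{k ≥ 2} w_k (1 - k) y^k / k!` in `y`. -/
noncomputable def kSeries (w : ℕ → R) : PowerSeries R :=
  PowerSeries.X +
    PowerSeries.mk fun k => if 2 ≤ k then w k * (1 - (k : R)) / (k.factorial : R) else 0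

/-- The polynomials `Π_s(lam; w)` in `lam`, given by
`exp[lam (y + ∑_{k ≥ 2} w_k (1 - k) y^k / k!)] = ∑_s Π_s(lam; w) y^s / s!`.
The number `π_{s,p}(w)` is the coefficient of `lam^p` in `Π_s(lam; w)`. -/
noncomputable def polyPi (s : ℕ) (w : ℕ → R) : Polynomial R :=
  (s.factorial : Polynomial R) * PowerSeries.coeff s (expMulIndet (kSeries w))

end Polynomials

end Hyperforest

/-! Both halves of the proof are weighted double counts of hyperforests, matched with recursions
read off the generating series. The common tool is `card_reaches`, which implies that in each
component the number of vertices minus `∑ (|A| - 1)` over its hyperedges is one.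

Unrooted sums: for an independent set `D`, let `indepSum w p D` collect the hyperforests with `p`
components besides those meeting `D`. Count the `p + 1` components missing `D` as vertices minus `∑
(|A| - 1)`, and mark a vertex or a hyperedge accordingly. Adding the vertex to `D`, or deleting the
hyperedge and adding its vertices, gives `natCast_succ_mul_indepSum`, with a singleton standing for
a vertex. This is the recursion `coeff_polyPi_succ`, so `indepSum_eq_sum_polyPi` expands `indepSum`
over root sets; `D = ∅` expresses `u` through `t`.

Rooted sums: for a root set `S`, `n - |S| = ∑ (|A| - 1)`. Deleting a marked hyperedge turns all but
one of its vertices into a set `B` of new roots, and the remaining vertex is arbitrary in the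
components rooted in `S`. By symmetry among the roots in `S ∪ B`, these components carry the
fraction `|S| / |S ∪ B|` of the weighted vertex count. The outcome is the recursion
`natCast_mul_eval_polyP` at `x = n`, whence `card_mul_rootedSum`; summing over `S` gives the
binomial form. -/

namespace Hyperforest

/-! ### Coefficient recursions for the exponential series. -/

section SeriesRecursions

open PowerSeries

variable {R : Type*} [Field R]

theorem constantCoeff_thetaSeries (w : ℕ → R) : constantCoeff (thetaSeries w) = 0 := by
  rw [← coeff_zero_eq_constantCoeff_apply]
  simp [thetaSeries]

theorem constantCoeff_kSeries (w : ℕ → R) : constantCoeff (kSeries w) = 0 := by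
  rw [← coeff_zero_eq_constantCoeff_apply]
  simp [kSeries]

/-- `K_j = j! [y^j] (y + ∑_{k ≥ 2} w_k (1 - k) y^k / k!)`. -/
noncomputable def kWeight (w : ℕ → R) (j : ℕ) : R :=
  (j.factorial : R) * coeff j (kSeries w)

theorem kWeight_zero (w : ℕ → R) : kWeight w 0 = 0 := by
  simp [kWeight, kSeries]

theorem coeff_pow_eq_zero_of_lt {g : PowerSeries R} (hg : constantCoeff g = 0) {s d : ℕ}
    (hd : s < d) : coeff s (g ^ d) = 0 :=
  coeff_of_lt_order _ (lt_of_lt_of_le (by exact_mod_cast hd)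
    (le_order_pow_of_constantCoeff_eq_zero d hg))

variable [CharZero R]

/-- The term `x^d g^d / d!` is the only one of degree `d` in `x`, and `g^d` starts at `y^d`, so the
sum defining the substitution is finite. -/
theorem coeff_coeff_expMulIndet {g : PowerSeries R} (hg : constantCoeff g = 0) (s p : ℕ) :
    (coeff s (expMulIndet g)).coeff p = coeff s (g ^ p) / (p.factorial : R) := by
  have hc : constantCoeff
      (PowerSeries.C Polynomial.X * PowerSeries.map Polynomial.C g) = 0 := by
    rw [map_mul, ← coeff_zero_eq_constantCoeff_apply (PowerSeries.map Polynomial.C g), coeff_map,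
      coeff_zero_eq_constantCoeff_apply, hg]
    simp
  have hs : HasSubst (PowerSeries.C Polynomial.X * PowerSeries.map Polynomial.C g) :=
    HasSubst.of_constantCoeff_zero' hc
  have hterm : ∀ d : ℕ, coeff d (PowerSeries.exp (Polynomial R)) •
      coeff s ((PowerSeries.C Polynomial.X * PowerSeries.map Polynomial.C g) ^ d) =
      Polynomial.C (coeff s (g ^ d) / (d.factorial : R)) * Polynomial.X ^ d := by
    intro d
    rw [mul_pow, ← map_pow, ← map_pow, coeff_C_mul, coeff_map, coeff_exp, smul_eq_mul,
      IsScalarTower.algebraMap_apply ℚ R (Polynomial R), map_div₀ (algebraMap ℚ R), map_one,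
      Polynomial.algebraMap_eq, map_natCast, one_div]
    simp only [div_eq_mul_inv, map_mul]
    ring
  rw [expMulIndet, PowerSeries.coeff_subst' hs,
    finsum_eq_sum_of_support_subset (s := Finset.range (s + 1))]
  · simp_rw [hterm, Polynomial.finsetSum_coeff, Polynomial.coeff_C_mul, Polynomial.coeff_X_pow]
    simp only [mul_ite, mul_one, mul_zero, Finset.sum_ite_eq, Finset.mem_range]
    split_ifs with h
    · rfl
    · rw [coeff_pow_eq_zero_of_lt hg (by omega), zero_div]
  · intro d hd
    simp only [Function.mem_support] at hd
    by_contra hlt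
    apply hd
    have : s < d := by simpa using hlt
    rw [hterm, coeff_pow_eq_zero_of_lt hg this]
    simp

theorem kWeight_of_pos (w : ℕ → R) {j : ℕ} (hj : 1 ≤ j) :
    kWeight w j = (if j = 1 then 1 else 0) + w j * (1 - (j : R)) := by
  have : (j.factorial : R) ≠ 0 := by exact_mod_cast j.factorial_ne_zero
  rcases eq_or_ne j 1 with rfl | h
  · simp [kWeight, kSeries]
  · have h2 : 2 ≤ j := by omega
    simp only [kWeight, kSeries, map_add, coeff_X, h, if_false, coeff_mk, h2, if_true, zero_add]
    field_simp

theorem coeff_polyPi (w : ℕ → R) (s p : ℕ) :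
    (polyPi s w).coeff p = s.factorial * (coeff s (kSeries w ^ p) / (p.factorial : R)) := by
  rw [polyPi, ← Polynomial.C_eq_natCast, Polynomial.coeff_C_mul,
    coeff_coeff_expMulIndet (constantCoeff_kSeries w)]

theorem natDegree_polyPi_le (w : ℕ → R) (s : ℕ) : (polyPi s w).natDegree ≤ s := by
  refine Polynomial.natDegree_le_iff_coeff_eq_zero.2 fun p hp => ?_
  rw [coeff_polyPi, coeff_pow_eq_zero_of_lt (constantCoeff_kSeries w) hp, zero_div, mul_zero]

theorem coeff_polyPi_zero_right (w : ℕ → R) (s : ℕ) :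
    (polyPi s w).coeff 0 = if s = 0 then 1 else 0 := by
  rw [coeff_polyPi, pow_zero, coeff_one]
  split_ifs with h <;> simp [h]

/-- Cauchy product for one factor split off `kSeries w ^ (p + 1)`; the factor `p + 1` reduces `(p +
1)!` to `p!`. -/
theorem coeff_polyPi_succ (w : ℕ → R) (s p : ℕ) :
    ((p : R) + 1) * (polyPi s w).coeff (p + 1) =
      ∑ j ∈ Finset.range (s + 1),
        (s.choose j : R) * (kWeight w j * (polyPi (s - j) w).coeff p) := by
  have hp : (p.factorial : R) ≠ 0 := by exact_mod_cast p.factorial_ne_zero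
  have hp' : (p : R) + 1 ≠ 0 := by exact_mod_cast p.succ_ne_zero
  rw [coeff_polyPi, pow_succ', coeff_mul,
    Finset.Nat.sum_antidiagonal_eq_sum_range_succ_mk, Nat.factorial_succ, Finset.sum_div,
    Finset.mul_sum, Finset.mul_sum]
  refine Finset.sum_congr rfl fun j hj => ?_
  have hj' : j ≤ s := by simpa [Nat.lt_succ_iff] using hj
  rw [coeff_polyPi, kWeight, ← Nat.choose_mul_factorial_mul_factorial hj']
  push_cast
  field_simp

theorem coeff_polyP (w : ℕ → R) (s p : ℕ) :
    (polyP s w).coeff p = s.factorial * (coeff s (thetaSeries w ^ p) / (p.factorial : R)) := by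
  rw [polyP, ← Polynomial.C_eq_natCast, Polynomial.coeff_C_mul,
    coeff_coeff_expMulIndet (constantCoeff_thetaSeries w)]

theorem polyP_zero (w : ℕ → R) : polyP 0 w = 1 := by
  ext p
  rw [coeff_polyP, coeff_zero_eq_constantCoeff_apply, map_pow, constantCoeff_thetaSeries,
    Polynomial.coeff_one]
  rcases eq_or_ne p 0 with rfl | h <;> simp [*]

/-- Applies `y d/dy` to `g^(p+1)`, giving `(p + 1) (y g') g^p`. -/
theorem natCast_mul_coeff_pow_succ (g : PowerSeries R) (m p : ℕ) :
    (m : R) * coeff m (g ^ (p + 1)) =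
      ((p : R) + 1) * ∑ j ∈ Finset.range (m + 1), (j : R) * coeff j g * coeff (m - j) (g ^ p) := by
  cases m with
  | zero => simp
  | succ m =>
    have h : coeff m (derivative R (g ^ (p + 1))) =
        coeff m (((p : R) + 1) • (derivative R g * g ^ p)) := by
      congr 1
      rw [Derivation.leibniz_pow, Nat.add_sub_cancel, smul_eq_mul, ← Nat.cast_smul_eq_nsmul R]
      push_cast
      rw [mul_comm]
    rw [coeff_derivative, coeff_smul, coeff_mul,
      Finset.Nat.sum_antidiagonal_eq_sum_range_succ_mk, smul_eq_mul] at h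
    rw [Finset.sum_range_succ']
    push_cast
    rw [mul_comm, h]
    congr 1
    rw [zero_mul, zero_mul, add_zero]
    refine Finset.sum_congr rfl fun j _ => ?_
    simp only [coeff_derivative]
    ring

/-- The differential equation `y ∂_y exp(xθ) = x (y θ') exp(xθ)`, compared degree by degree in `x`.
-/
theorem natCast_mul_polyP (w : ℕ → R) (m : ℕ) :
    (m : Polynomial R) * polyP m w =
      Polynomial.X * ∑ j ∈ Finset.range (m + 1),
        Polynomial.C ((m.choose j : R) * ((j : R) * w (j + 1))) * polyP (m - j) w := by
  ext p
  rw [← Polynomial.C_eq_natCast, Polynomial.coeff_C_mul]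
  cases p with
  | zero =>
    rw [coeff_polyP, pow_zero, coeff_one, Polynomial.coeff_X_mul_zero]
    split_ifs with h <;> simp [h]
  | succ p =>
    have hp : (p.factorial : R) ≠ 0 := by exact_mod_cast p.factorial_ne_zero
    have hp' : (p : R) + 1 ≠ 0 := by exact_mod_cast p.succ_ne_zero
    have hm : (m : R) * ((m.factorial : R) * (coeff m (thetaSeries w ^ (p + 1)) /
        ((p + 1).factorial : R))) = (m.factorial : R) / ((p + 1).factorial : R) *
        ((m : R) * coeff m (thetaSeries w ^ (p + 1))) := by ring
    rw [coeff_polyP, Polynomial.coeff_X_mul, hm, natCast_mul_coeff_pow_succ,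
      Polynomial.finsetSum_coeff, Finset.mul_sum, Finset.mul_sum]
    refine Finset.sum_congr rfl fun j hj => ?_
    have hj' : j ≤ m := by simpa [Nat.lt_succ_iff] using hj
    have hjf : (j.factorial : R) ≠ 0 := by exact_mod_cast j.factorial_ne_zero
    rw [Polynomial.coeff_C_mul, coeff_polyP, ← Nat.choose_mul_factorial_mul_factorial hj',
      Nat.factorial_succ, thetaSeries, coeff_mk]
    rcases Nat.eq_zero_or_pos j with rfl | hpos
    · simp
    · rw [if_pos (by omega)]
      push_cast
      field_simp

theorem natCast_mul_eval_polyP (w : ℕ → R) (m : ℕ) (x : R) :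
    (m : R) * (polyP m w).eval x =
      x * ∑ j ∈ Finset.range (m + 1),
        (m.choose j : R) * ((j : R) * w (j + 1) * (polyP (m - j) w).eval x) := by
  have h := congrArg (Polynomial.eval x) (natCast_mul_polyP w m)
  simpa [Polynomial.eval_finsetSum, mul_assoc] using h

end SeriesRecursions

end Hyperforest

namespace Hyperforest

/-! ### Connectivity, independent sets and acyclicity. -/

section Acyclicity

variable {V : Type*}

theorem Joined.mono {F G : Finset (Finset V)} (h : F ⊆ G) {u v : V} (huv : Joined F u v) :
    Joined G u v := by
  induction huv with
  | refl => exact Relation.ReflTransGen.refl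
  | tail _ hbc ih =>
    obtain ⟨A, hA, hb, hc⟩ := hbc
    exact ih.tail ⟨A, h hA, hb, hc⟩

theorem joined_of_mem {F : Finset (Finset V)} {A : Finset V} (hA : A ∈ F) {u v : V}
    (hu : u ∈ A) (hv : v ∈ A) : Joined F u v :=
  Relation.ReflTransGen.single ⟨A, hA, hu, hv⟩

theorem Joined.rfl {F : Finset (Finset V)} {u : V} : Joined F u u :=
  Relation.ReflTransGen.refl

/-- Distinct elements of `D` lie in distinct components of `(V, F)`. -/
def Indep (F : Finset (Finset V)) (D : Finset V) : Prop :=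
  ∀ ⦃u⦄, u ∈ D → ∀ ⦃v⦄, v ∈ D → Joined F u v → u = v

theorem Indep.anti_left {F G : Finset (Finset V)} (h : F ⊆ G) {D : Finset V} (hD : Indep G D) :
    Indep F D :=
  fun _ hu _ hv huv => hD hu hv (huv.mono h)

theorem Indep.anti_right {F : Finset (Finset V)} {D E : Finset V} (h : D ⊆ E)
    (hE : Indep F E) : Indep F D :=
  fun _ hu _ hv huv => hE (h hu) (h hv) huv

theorem Indep.notMem_of_two_le_card {F : Finset (Finset V)} {A : Finset V} (h : Indep F A)
    (hA : 2 ≤ A.card) : A ∉ F := by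
  intro hAF
  obtain ⟨u, hu, v, hv, huv⟩ := Finset.one_lt_card.1 hA
  exact huv (h hu hv (joined_of_mem hAF hu hv))

/-- A shortest chain from `u` to `v`, together with the distance from `u`. -/
theorem exists_geodesic {r : V → V → Prop} {u v : V} (h : Relation.ReflTransGen r u v) :
    ∃ (m : ℕ) (x : ℕ → V) (d : V → ℕ), x 0 = u ∧ x m = v ∧ (∀ i < m, r (x i) (x (i + 1))) ∧
      (∀ i ≤ m, d (x i) = i) ∧ ∀ i ≤ m, ∀ b, r (x i) b → d b ≤ i + 1 := by
  classical
  let Q : V → ℕ → Prop := fun a n =>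
    ∃ x : ℕ → V, x 0 = u ∧ x n = a ∧ ∀ i < n, r (x i) (x (i + 1))
  let d : V → ℕ := fun a => sInf {n | Q a n}
  have hQ_step : ∀ a b n, Q a n → r a b → Q b (n + 1) := by
    rintro a b n ⟨x, h0, hn, hx⟩ hab
    refine ⟨fun i => if i ≤ n then x i else b, by simp [h0], by simp, fun i hi => ?_⟩
    rcases Nat.lt_succ_iff_lt_or_eq.1 hi with hlt | rfl
    · simpa [hlt.le, Nat.succ_le_of_lt hlt] using hx i hlt
    · simpa [hn] using hab
  have hne : ∃ n, Q v n := by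
    induction h with
    | refl => exact ⟨0, fun _ => u, rfl, rfl, by simp⟩
    | tail _ hbc ih =>
      obtain ⟨n, hn⟩ := ih
      exact ⟨n + 1, hQ_step _ _ _ hn hbc⟩
  obtain ⟨x, h0, hm, hx⟩ : Q v (d v) := Nat.sInf_mem hne
  have hQx : ∀ i ≤ d v, Q (x i) i := fun i hi =>
    ⟨x, h0, rfl, fun j hj => hx j (hj.trans_le hi)⟩
  have hle : ∀ i ≤ d v, d (x i) ≤ i := fun i hi => Nat.sInf_le (hQx i hi)
  have hstep : ∀ i ≤ d v, ∀ b, r (x i) b → d b ≤ d (x i) + 1 := fun i hi b hb =>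
    Nat.sInf_le (hQ_step _ _ _
      (Nat.sInf_mem (s := {n | Q (x i) n}) ⟨i, hQx i hi⟩) hb)
  -- Distance grows by at most one per step, so walking back from `v` no vertex of the chain can be
  -- closer to `u` than its index.
  have hge : ∀ j ≤ d v, d v ≤ d (x (d v - j)) + j := by
    intro j
    induction j with
    | zero => simp [hm]
    | succ j ih =>
      intro hj
      have h1 := ih (by omega)
      have h2 := hstep (d v - (j + 1)) (by omega) _ (hx _ (by omega))
      rw [show d v - (j + 1) + 1 = d v - j by omega] at h2
      omega
  have heq : ∀ i ≤ d v, d (x i) = i := by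
    intro i hi
    have h1 := hge (d v - i) (by omega)
    rw [show d v - (d v - i) = i by omega] at h1
    have := hle i hi
    omega
  exact ⟨d v, x, d, h0, hm, hx, heq, fun i hi b hb => (hstep i hi b hb).trans_eq (by rw [heq i hi])⟩

/-- `v` lies in a component of `(V, F)` that meets `D`. -/
def Reaches (F : Finset (Finset V)) (D : Finset V) (v : V) : Prop :=
  ∃ d ∈ D, Joined F d v

/-- `∑_{A ∈ F} (|A| - 1)`. -/
def excess (F : Finset (Finset V)) : ℕ :=
  ∑ A ∈ F, (A.card - 1)

theorem isRootSet_iff {F : Finset (Finset V)} {S : Finset V} :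
    IsRootSet F S ↔ Indep F S ∧ ∀ v, Reaches F S v := by
  constructor
  · refine fun h => ⟨fun u hu v hv huv => ?_, fun v => ?_⟩
    · obtain ⟨r, _, hr⟩ := h u
      rw [hr u ⟨hu, Joined.rfl⟩, hr v ⟨hv, huv⟩]
    · obtain ⟨r, ⟨hr, hvr⟩, _⟩ := h v
      exact ⟨r, hr, hvr.symm⟩
  · rintro ⟨h1, h2⟩ v
    obtain ⟨d, hd, hdv⟩ := h2 v
    exact ⟨d, ⟨hd, hdv.symm⟩, fun r ⟨hr, hvr⟩ => (h1 hd hr (hdv.trans hvr)).symm⟩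

theorem IsRootSet.card_eq_numComponents {F : Finset (Finset V)} {S : Finset V}
    (hS : IsRootSet F S) : S.card = numComponents F := by
  rw [numComponents, ← Nat.card_eq_finsetCard]
  refine Nat.card_eq_of_bijective
    (fun s : S => (Quotient.mk (joinedSetoid F) (s : V))) ⟨fun s t hst => ?_, fun q => ?_⟩
  · exact Subtype.ext ((isRootSet_iff.1 hS).1 s.2 t.2 (Quotient.exact hst))
  · induction q using Quotient.inductionOn with
    | h v =>
      obtain ⟨r, hr, hrv⟩ := (isRootSet_iff.1 hS).2 v
      exact ⟨⟨r, hr⟩, Quotient.sound hrv⟩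

variable [DecidableEq V]

/-- A walk through `A` can be cut at its first and last visits to `A`, leaving outer pieces in `F`.
-/
theorem joined_insert_iff {F : Finset (Finset V)} {A : Finset V} {u v : V} :
    Joined (insert A F) u v ↔
      Joined F u v ∨ (∃ a ∈ A, Joined F u a) ∧ ∃ b ∈ A, Joined F b v := by
  constructor
  · intro h
    induction h with
    | refl => exact Or.inl Joined.rfl
    | @tail b c _ hbc ih =>
      obtain ⟨B, hB, hb, hc⟩ := hbc
      rcases Finset.mem_insert.1 hB with rfl | hBF
      · refine Or.inr ⟨?_, c, hc, Joined.rfl⟩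
        rcases ih with ih | ih
        · exact ⟨b, hb, ih⟩
        · exact ih.1
      · have hj : Joined F b c := joined_of_mem hBF hb hc
        rcases ih with ih | ⟨ih, a, ha, hab⟩
        · exact Or.inl (ih.trans hj)
        · exact Or.inr ⟨ih, a, ha, hab.trans hj⟩
  · rintro (h | ⟨⟨a, ha, hua⟩, b, hb, hbv⟩)
    · exact h.mono (Finset.subset_insert _ _)
    · exact ((hua.mono (Finset.subset_insert _ _)).trans
        (joined_of_mem (Finset.mem_insert_self _ _) ha hb)).trans
        (hbv.mono (Finset.subset_insert _ _))

/-- Removing a hyperedge separates all its vertices from each other. -/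
def Acyclic (F : Finset (Finset V)) : Prop :=
  ∀ A ∈ F, Indep (F.erase A) A

/-- Removing `e 0` from a cycle leaves the walk from `v 1` round to `v 0`, two distinct vertices of
`e 0`. -/
theorem Acyclic.isHyperforest {F : Finset (Finset V)} (h : Acyclic F) : IsHyperforest F := by
  rintro k v e ⟨hk, he, hkv, hv, hinj⟩
  have chain : ∀ i j, i ≤ j → j ≤ k → (∀ l, i ≤ l → l < j → e l ≠ e 0) →
      Joined (F.erase (e 0)) (v i) (v j) := by
    intro i j hij
    induction j, hij using Nat.le_induction with
    | base => exact fun _ _ => Joined.rfl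
    | succ j hij ih =>
      intro hj hne
      refine (ih (by omega) fun l hl hl' => hne l hl (by omega)).trans ?_
      obtain ⟨h1, h2, h3⟩ := he j (by omega)
      exact joined_of_mem (Finset.mem_erase.2 ⟨hne j hij (by omega), h1⟩) h2 h3
  have h1 : Joined (F.erase (e 0)) (v 1) (v 0) := by
    rw [← hkv]
    refine chain 1 k (by omega) le_rfl fun l hl hlk heq => ?_
    have := hinj (Set.mem_Iio.2 hlk) (Set.mem_Iio.2 (by omega)) heq
    omega
  obtain ⟨h2, h3, h4⟩ := he 0 (by omega)
  have := hv (Set.mem_Iio.2 (by omega)) (Set.mem_Iio.2 (by omega)) (h _ h2 h4 h3 h1)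
  omega

/-- If two vertices of `A` are joined without `A`, a shortest chain between them closes up through
`A` to a cycle. -/
theorem IsHyperforest.acyclic {F : Finset (Finset V)} (h : IsHyperforest F) : Acyclic F := by
  intro A hA u hu w hw huw
  by_contra hne
  obtain ⟨m, x, d, h0, hm, hx, hd, hstep⟩ := exists_geodesic huw
  have hm0 : m ≠ 0 := by
    rintro rfl
    exact hne (h0.symm.trans hm)
  choose! e he using hx
  -- The value `x 0` past the end closes the walk, and `A` is the last hyperedge; `m ≠ 0` makes the
  -- length at least two.
  refine h (m + 1) (fun i => if i ≤ m then x i else x 0) (fun i => if i < m then e i else A)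
    ⟨by omega, fun i hi => ?_, by simp, ?_, ?_⟩
  · rcases Nat.lt_succ_iff_lt_or_eq.1 hi with hlt | rfl
    · obtain ⟨h1, h2, h3⟩ := he i hlt
      simp only [hlt, hlt.le, Nat.succ_le_of_lt hlt, if_true]
      exact ⟨Finset.mem_of_mem_erase h1, h2, h3⟩
    · simp only [lt_irrefl, le_refl, if_true, if_false, Nat.not_succ_le_self, h0, hm]
      exact ⟨hA, hw, hu⟩
  · intro i hi j hj hij
    have hi' : i ≤ m := Nat.lt_succ_iff.1 hi
    have hj' : j ≤ m := Nat.lt_succ_iff.1 hj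
    simp only [hi', hj', if_true] at hij
    rw [← hd i hi', ← hd j hj', hij]
  · have key : ∀ i j, i < j → j < m + 1 →
        (if i < m then e i else A) ≠ (if j < m then e j else A) := by
      intro i j hij hj heq
      have hi : i < m := by omega
      rw [if_pos hi] at heq
      split_ifs at heq with hjm
      -- A hyperedge used at both `i` and `j > i` would place `x (j + 1)` within distance `i + 1`.
      · have := hstep i hi.le (x (j + 1)) ⟨e i, (he i hi).1, (he i hi).2.1, heq ▸ (he j hjm).2.2⟩
        rw [hd (j + 1) (by omega)] at this
        omega
      · exact Finset.ne_of_mem_erase (he i hi).1 heq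
    intro i hi j hj hij
    rcases lt_trichotomy i j with hlt | heq | hlt
    · exact absurd hij (key i j hlt hj)
    · exact heq
    · exact absurd hij.symm (key j i hlt hi)

theorem isHyperforest_iff_acyclic {F : Finset (Finset V)} : IsHyperforest F ↔ Acyclic F :=
  ⟨IsHyperforest.acyclic, Acyclic.isHyperforest⟩

/-- For the converse, a walk through `A` between two vertices of `B ∈ F` enters and leaves `A` at
vertices joined in `F` via `B`. These coincide by independence, so the walk can skip `A`. -/
theorem acyclic_insert_iff {F : Finset (Finset V)} {A : Finset V} (hA : A ∉ F) :
    Acyclic (insert A F) ↔ Acyclic F ∧ Indep F A := by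
  constructor
  · intro h
    refine ⟨fun B hB => (h B (Finset.mem_insert_of_mem hB)).anti_left
      (Finset.erase_subset_erase _ (Finset.subset_insert _ _)), ?_⟩
    simpa [Finset.erase_insert hA] using h A (Finset.mem_insert_self _ _)
  · rintro ⟨hF, hAi⟩ B hB
    rcases Finset.mem_insert.1 hB with rfl | hBF
    · rwa [Finset.erase_insert hA]
    · have hne : A ≠ B := fun h => hA (h ▸ hBF)
      intro u hu v hv huv
      rw [Finset.erase_insert_of_ne hne, joined_insert_iff] at huv
      rcases huv with huv | ⟨⟨a, ha, hua⟩, b, hb, hbv⟩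
      · exact hF B hBF hu hv huv
      · have hsub : F.erase B ⊆ F := Finset.erase_subset _ _
        have hab : a = b := hAi ha hb
          (((hua.mono hsub).symm.trans (joined_of_mem hBF hu hv)).trans (hbv.mono hsub).symm)
        exact hF B hBF hu hv (hua.trans (hab ▸ hbv))

/-- Inserting a hyperedge keeps `D` independent and leaves `A` unreached from `D` if and only if
`A ∪ D` was independent before, `A` and `D` being disjoint. -/
theorem indep_insert_and_not_reaches_iff {F : Finset (Finset V)} {A D : Finset V} :
    (Indep F A ∧ Indep (insert A F) D ∧ ¬ ∃ a ∈ A, Reaches (insert A F) D a) ↔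
      Disjoint A D ∧ Indep F (A ∪ D) := by
  constructor
  · rintro ⟨hAi, hD, hr⟩
    have hDF : Indep F D := hD.anti_left (Finset.subset_insert _ _)
    have hno : ∀ a ∈ A, ∀ d ∈ D, ¬ Joined F d a := fun a ha d hd h =>
      hr ⟨a, ha, d, hd, h.mono (Finset.subset_insert _ _)⟩
    refine ⟨Finset.disjoint_left.2 fun a ha hd => hno a ha a hd Joined.rfl, ?_⟩
    intro u hu v hv huv
    rcases Finset.mem_union.1 hu with hu | hu <;> rcases Finset.mem_union.1 hv with hv | hv
    · exact hAi hu hv huv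
    · exact absurd huv.symm (hno u hu v hv)
    · exact absurd huv (hno v hv u hu)
    · exact hDF hu hv huv
  · rintro ⟨hdisj, hI⟩
    have hno : ∀ a ∈ A, ∀ d ∈ D, ¬ Joined F d a := fun a ha d hd h =>
      Finset.disjoint_left.1 hdisj ha
        (hI (Finset.mem_union_right _ hd) (Finset.mem_union_left _ ha) h ▸ hd)
    refine ⟨hI.anti_right Finset.subset_union_left, fun u hu v hv huv => ?_, ?_⟩
    · rcases joined_insert_iff.1 huv with huv | ⟨⟨a, ha, hua⟩, _⟩
      · exact hI (Finset.mem_union_right _ hu) (Finset.mem_union_right _ hv) huv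
      · exact absurd hua (hno a ha u hu)
    · rintro ⟨a, ha, d, hd, hda⟩
      rcases joined_insert_iff.1 hda with h | ⟨⟨b, hb, h⟩, _⟩
      · exact hno a ha d hd h
      · exact hno b hb d hd h

/-- If `D` is independent in `F ∪ {A}` and `A` is reached from `r ∈ D`, then in `F` the vertex
`r` can be replaced by the vertices of `A`. -/
theorem indep_erase_union {F : Finset (Finset V)} {A D : Finset V} {r : V}
    (hAi : Indep F A) (hD : Indep (insert A F) D) (hr : r ∈ D) {a₀ : V} (ha₀ : a₀ ∈ A)
    (hra : Joined (insert A F) r a₀) :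
    Disjoint (D.erase r) A ∧ Indep F (D.erase r ∪ A) ∧
      ∀ v, Reaches F (D.erase r ∪ A) v ↔ Reaches (insert A F) D v := by
  have hsub : F ⊆ insert A F := Finset.subset_insert _ _
  have hrA : ∀ a ∈ A, Joined (insert A F) r a := fun a ha =>
    hra.trans (joined_of_mem (Finset.mem_insert_self _ _) ha₀ ha)
  have hno : ∀ d ∈ D.erase r, ∀ a ∈ A, ¬ Joined F d a := fun d hd a ha h =>
    Finset.ne_of_mem_erase hd
      (hD (Finset.mem_of_mem_erase hd) hr ((h.mono hsub).trans (hrA a ha).symm))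
  have hDF := hD.anti_left hsub
  obtain ⟨a₁, ha₁, hra₁⟩ : ∃ a ∈ A, Joined F r a := by
    rcases joined_insert_iff.1 hra with h | ⟨h, _⟩
    exacts [⟨a₀, ha₀, h⟩, h]
  refine ⟨Finset.disjoint_left.2 fun d hd hdA => hno d hd d hdA Joined.rfl, ?_, fun v => ?_⟩
  · intro u hu v hv huv
    rcases Finset.mem_union.1 hu with hu | hu <;> rcases Finset.mem_union.1 hv with hv | hv
    · exact hDF (Finset.mem_of_mem_erase hu) (Finset.mem_of_mem_erase hv) huv
    · exact absurd huv (hno u hu v hv)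
    · exact absurd huv.symm (hno v hv u hu)
    · exact hAi hu hv huv
  · constructor
    · rintro ⟨d, hd, hdv⟩
      rcases Finset.mem_union.1 hd with hd | hd
      · exact ⟨d, Finset.mem_of_mem_erase hd, hdv.mono hsub⟩
      · exact ⟨r, hr, (hrA d hd).trans (hdv.mono hsub)⟩
    · rintro ⟨d, hd, hdv⟩
      rcases joined_insert_iff.1 hdv with h | ⟨_, b, hb, hbv⟩
      · rcases eq_or_ne d r with rfl | hne
        · exact ⟨a₁, Finset.mem_union_right _ ha₁, hra₁.symm.trans h⟩
        · exact ⟨d, Finset.mem_union_left _ (Finset.mem_erase.2 ⟨hne, hd⟩), h⟩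
      · exact ⟨b, Finset.mem_union_right _ hb, hbv⟩

open Classical in
/-- In a hyperforest the components that meet an independent set `D` have
`|D| + ∑ (|A| - 1)` vertices, the sum being over their hyperedges. -/
theorem card_reaches [Fintype V] {F : Finset (Finset V)} (hF : Acyclic F)
    (hne : ∀ A ∈ F, A.Nonempty) {D : Finset V} (hD : Indep F D) :
    (Finset.univ.filter (Reaches F D)).card =
      D.card + ∑ A ∈ F with ∃ a ∈ A, Reaches F D a, (A.card - 1) := by
  induction F using Finset.induction_on generalizing D with
  | empty =>
    have : ∀ v, Reaches ∅ D v ↔ v ∈ D := by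
      intro v
      constructor
      · rintro ⟨d, hd, h⟩
        rcases Relation.ReflTransGen.cases_tail h with h | ⟨c, _, B, hB, _⟩
        · exact h ▸ hd
        · simp at hB
      · exact fun h => ⟨v, h, Joined.rfl⟩
    simp [this]
  | insert A F hAF ih =>
    obtain ⟨hF', hAi⟩ := (acyclic_insert_iff hAF).1 hF
    have hne' : ∀ B ∈ F, B.Nonempty := fun B hB => hne B (Finset.mem_insert_of_mem hB)
    have hA := hne A (Finset.mem_insert_self _ _)
    by_cases hr : ∃ a ∈ A, Reaches (insert A F) D a
    · obtain ⟨a₀, ha₀, r, hrD, hra⟩ := hr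
      -- Trading `r` for the vertices of `A` keeps the reached set and enlarges `D` by `|A| - 1`,
      -- the contribution of the deleted hyperedge.
      obtain ⟨h1, h2, h3⟩ := indep_erase_union hAi hD hrD ha₀ hra
      have := ih hF' hne' h2
      simp only [h3] at this
      rw [Finset.filter_insert, if_pos ⟨a₀, ha₀, r, hrD, hra⟩,
        Finset.sum_insert (fun h => hAF (Finset.mem_filter.1 h).1), this,
        Finset.card_union_of_disjoint h1, Finset.card_erase_of_mem hrD]
      have := Finset.card_pos.2 hA
      have := Finset.card_pos.2 ⟨r, hrD⟩
      omega
    · have h3 : ∀ v, Reaches (insert A F) D v ↔ Reaches F D v := by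
        intro v
        constructor
        · rintro ⟨d, hd, hdv⟩
          rcases joined_insert_iff.1 hdv with h | ⟨⟨a, ha, h⟩, _⟩
          · exact ⟨d, hd, h⟩
          · exact absurd ⟨a, ha, d, hd, h.mono (Finset.subset_insert _ _)⟩ hr
        · rintro ⟨d, hd, hdv⟩
          exact ⟨d, hd, hdv.mono (Finset.subset_insert _ _)⟩
      rw [Finset.filter_insert, if_neg hr]
      simp only [h3]
      exact ih hF' hne' (hD.anti_left (Finset.subset_insert _ _))

theorem IsRootSet.card_add_excess [Fintype V] {F : Finset (Finset V)} (hF : Acyclic F)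
    (hne : ∀ A ∈ F, A.Nonempty) {S : Finset V} (hS : IsRootSet F S) :
    S.card + excess F = Fintype.card V := by
  classical
  obtain ⟨h1, h2⟩ := isRootSet_iff.1 hS
  have h := card_reaches hF hne h1
  rw [Finset.filter_true_of_mem (fun v _ => h2 v), Finset.card_univ, Finset.filter_true_of_mem
    (fun A hA => (hne A hA).imp fun a ha => ⟨ha, h2 a⟩)] at h
  exact h.symm

/-- A maximal independent superset of `D` meets every component. -/
theorem Indep.exists_isRootSet [Fintype V] {F : Finset (Finset V)} {D : Finset V}
    (hD : Indep F D) : ∃ S, D ⊆ S ∧ IsRootSet F S := by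
  classical
  obtain ⟨S, hS, hmax⟩ := (Finset.univ.filter fun S => D ⊆ S ∧ Indep F S).exists_maximal
    ⟨D, by simp [hD]⟩
  simp only [Finset.mem_filter, Finset.mem_univ, true_and] at hS hmax
  refine ⟨S, hS.1, isRootSet_iff.2 ⟨hS.2, fun v => ?_⟩⟩
  by_contra hv
  have hvS : v ∉ S := fun h => hv ⟨v, h, Joined.rfl⟩
  have hins : Indep F (insert v S) := by
    intro a ha b hb hab
    rcases Finset.mem_insert.1 ha with ha | ha <;> rcases Finset.mem_insert.1 hb with hb | hb
    · rw [ha, hb]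
    · exact absurd ⟨b, hb, ha ▸ hab.symm⟩ hv
    · exact absurd ⟨a, ha, hb ▸ hab⟩ hv
    · exact hS.2 ha hb hab
  exact hvS (hmax ⟨hS.1.trans (Finset.subset_insert _ _), hins⟩ (Finset.subset_insert _ _)
    (Finset.mem_insert_self _ _))

theorem indep_insert_iff {F : Finset (Finset V)} {D : Finset V} {v : V} (hv : v ∉ D) :
    Indep F (insert v D) ↔ Indep F D ∧ ¬ Reaches F D v := by
  constructor
  · refine fun h => ⟨h.anti_right (Finset.subset_insert _ _), ?_⟩
    rintro ⟨d, hd, hdv⟩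
    exact hv (h (Finset.mem_insert_of_mem hd) (Finset.mem_insert_self _ _) hdv ▸ hd)
  · rintro ⟨hD, hr⟩ a ha b hb hab
    rcases Finset.mem_insert.1 ha with ha | ha <;> rcases Finset.mem_insert.1 hb with hb | hb
    · rw [ha, hb]
    · exact absurd ⟨b, hb, ha ▸ hab.symm⟩ hr
    · exact absurd ⟨a, ha, hb ▸ hab⟩ hr
    · exact hD ha hb hab

/-- A hyperedge `B ∪ {x}` attaches the components rooted in `B` to the component of `x`. -/
theorem attach_iff {F : Finset (Finset V)} {B S : Finset V} {x : V} (hx : Reaches F S x) :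
    (x ∉ B ∧ Indep F (insert x B) ∧ IsRootSet (insert (insert x B) F) S) ↔
      Disjoint B S ∧ IsRootSet F (S ∪ B) := by
  obtain ⟨s, hs, hsx⟩ := hx
  have hsub : F ⊆ insert (insert x B) F := Finset.subset_insert _ _
  have hxB : ∀ b ∈ B, Joined (insert (insert x B) F) b x := fun b hb =>
    joined_of_mem (Finset.mem_insert_self _ _) (Finset.mem_insert_of_mem hb)
      (Finset.mem_insert_self _ _)
  rw [isRootSet_iff, isRootSet_iff]
  constructor
  · rintro ⟨hxB', hI, hS, hcov⟩
    have hno : ∀ b ∈ B, ∀ t ∈ S, ¬ Joined F t b := by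
      intro b hb t ht htb
      have hts : t = s := hS ht hs
        (((htb.mono hsub).trans (hxB b hb)).trans (hsx.mono hsub).symm)
      have hbx : b = x := hI (Finset.mem_insert_of_mem hb) (Finset.mem_insert_self _ _)
        (htb.symm.trans (hts ▸ hsx))
      exact hxB' (hbx ▸ hb)
    refine ⟨Finset.disjoint_left.2 fun b hb hbS => hno b hb b hbS Joined.rfl, ?_, fun v => ?_⟩
    · intro u hu v hv huv
      rcases Finset.mem_union.1 hu with hu | hu <;> rcases Finset.mem_union.1 hv with hv | hv
      · exact hS hu hv (huv.mono hsub)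
      · exact absurd huv (hno v hv u hu)
      · exact absurd huv.symm (hno u hu v hv)
      · exact hI (Finset.mem_insert_of_mem hu) (Finset.mem_insert_of_mem hv) huv
    · obtain ⟨t, ht, htv⟩ := hcov v
      rcases joined_insert_iff.1 htv with h | ⟨_, b, hb, hbv⟩
      · exact ⟨t, Finset.mem_union_left _ ht, h⟩
      · rcases Finset.mem_insert.1 hb with rfl | hb
        · exact ⟨s, Finset.mem_union_left _ hs, hsx.trans hbv⟩
        · exact ⟨b, Finset.mem_union_right _ hb, hbv⟩
  · rintro ⟨hd, hI, hcov⟩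
    have hno : ∀ b ∈ B, ∀ t ∈ S, ¬ Joined F t b := fun b hb t ht h =>
      Finset.disjoint_left.1 hd hb
        (hI (Finset.mem_union_left _ ht) (Finset.mem_union_right _ hb) h ▸ ht)
    have hxno : ∀ b ∈ B, ¬ Joined F x b := fun b hb h => hno b hb s hs (hsx.trans h)
    refine ⟨fun hxB' => hxno x hxB' Joined.rfl, ?_, ?_, fun v => ?_⟩
    · intro u hu v hv huv
      rcases Finset.mem_insert.1 hu with hu | hu <;> rcases Finset.mem_insert.1 hv with hv | hv
      · rw [hu, hv]
      · exact absurd (hu ▸ huv) (hxno v hv)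
      · exact absurd (hv ▸ huv).symm (hxno u hu)
      · exact hI (Finset.mem_union_right _ hu) (Finset.mem_union_right _ hv) huv
    · intro u hu v hv huv
      have hIS : Indep F S := hI.anti_right Finset.subset_union_left
      rcases joined_insert_iff.1 huv with huv | ⟨⟨a, ha, hua⟩, b, hb, hbv⟩
      · exact hIS hu hv huv
      · rcases Finset.mem_insert.1 ha with rfl | ha
        · rcases Finset.mem_insert.1 hb with rfl | hb
          · exact hIS hu hv (hua.trans hbv)
          · exact absurd hbv.symm (hno b hb v hv)
        · exact absurd hua (hno a ha u hu)
    · obtain ⟨t, ht, htv⟩ := hcov v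
      rcases Finset.mem_union.1 ht with ht | ht
      · exact ⟨t, ht, htv.mono hsub⟩
      · exact ⟨s, hs, ((hsx.mono hsub).trans (hxB t ht).symm).trans (htv.mono hsub)⟩

open Classical in
-- A walk from a root to `A` first meets `A` inside `F`, so such a vertex exists. Two of them would
-- share a root, hence be joined in `F`. It is the vertex at which `A` is attached.
theorem card_reached_vertices {F : Finset (Finset V)} {A S : Finset V} (hA : A.Nonempty)
    (hI : Indep F A) (hS : IsRootSet (insert A F) S) : (A.filter (Reaches F S)).card = 1 := by
  obtain ⟨hS, hcov⟩ := isRootSet_iff.1 hS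
  have hsub : F ⊆ insert A F := Finset.subset_insert _ _
  obtain ⟨a, ha⟩ := hA
  have hex : ∃ b ∈ A, Reaches F S b := by
    obtain ⟨s, hs, hsa⟩ := hcov a
    rcases joined_insert_iff.1 hsa with h | ⟨⟨b, hb, hsb⟩, _⟩
    exacts [⟨a, ha, s, hs, h⟩, ⟨b, hb, s, hs, hsb⟩]
  obtain ⟨b, hb, s, hs, hsb⟩ := hex
  refine Finset.card_eq_one.2 ⟨b, Finset.eq_singleton_iff_unique_mem.2
    ⟨Finset.mem_filter.2 ⟨hb, s, hs, hsb⟩, fun c hc => ?_⟩⟩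
  obtain ⟨hc, t, ht, htc⟩ := Finset.mem_filter.1 hc
  have hts : t = s := hS ht hs (((htc.mono hsub).trans
    (joined_of_mem (Finset.mem_insert_self _ _) hc hb)).trans (hsb.mono hsub).symm)
  exact hI hc hb (htc.symm.trans (hts ▸ hsb))

end Acyclicity
end Hyperforest

namespace Hyperforest

/-! ### Unrooted sums: the recursion on the number of components. -/

section ForestSums

open scoped Classical

variable {V : Type*} [Fintype V] [DecidableEq V]

/-- The sets of hyperedges of cardinality at least two that form a spanning hyperforest. -/
noncomputable def spanningForests (V : Type*) [Fintype V] [DecidableEq V] :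
    Finset (Finset (Finset V)) :=
  Finset.univ.filter fun F => (∀ A ∈ F, 2 ≤ A.card) ∧ Acyclic F

theorem mem_spanningForests {F : Finset (Finset V)} :
    F ∈ spanningForests V ↔ (∀ A ∈ F, 2 ≤ A.card) ∧ Acyclic F := by
  simp [spanningForests]

theorem nonempty_of_mem_spanningForests {F : Finset (Finset V)} (hF : F ∈ spanningForests V) :
    ∀ A ∈ F, A.Nonempty := fun A hA =>
  Finset.card_pos.1 (by have := (mem_spanningForests.1 hF).1 A hA; omega)

theorem insert_mem_spanningForests_iff {F : Finset (Finset V)} {A : Finset V} (hA : A ∉ F) :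
    insert A F ∈ spanningForests V ↔ F ∈ spanningForests V ∧ 2 ≤ A.card ∧ Indep F A := by
  rw [mem_spanningForests, mem_spanningForests, acyclic_insert_iff hA, Finset.forall_mem_insert]
  tauto

/-- An independent set extends to a root set, whose cardinality is forced by `excess`; equal
cardinality leaves no room for growth. -/
theorem isRootSet_iff_card {F : Finset (Finset V)} (hF : F ∈ spanningForests V) {S : Finset V} :
    IsRootSet F S ↔ Indep F S ∧ S.card + excess F = Fintype.card V := by
  have hne := nonempty_of_mem_spanningForests hF
  have hac := (mem_spanningForests.1 hF).2
  constructor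
  · exact fun h => ⟨(isRootSet_iff.1 h).1, h.card_add_excess hac hne⟩
  · rintro ⟨hI, hcard⟩
    obtain ⟨T, hST, hT⟩ := hI.exists_isRootSet
    have := hT.card_add_excess hac hne
    rwa [Finset.eq_of_subset_of_card_le hST (by omega)]

theorem numComponents_add_excess {F : Finset (Finset V)} (hF : F ∈ spanningForests V) :
    numComponents F + excess F = Fintype.card V := by
  have hI : Indep F ∅ := fun u hu => absurd hu (Finset.notMem_empty u)
  obtain ⟨S, _, hS⟩ := hI.exists_isRootSet
  rw [← hS.card_eq_numComponents]
  exact hS.card_add_excess (mem_spanningForests.1 hF).2 (nonempty_of_mem_spanningForests hF)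

variable {R : Type*} [Field R]

/-- The total weight of the spanning hyperforests with root set `S`. -/
noncomputable def rootedSum (w : ℕ → R) (S : Finset V) : R :=
  ∑ F ∈ spanningForests V with IsRootSet F S, weight w F

/-- The total weight of the spanning hyperforests with `|D| + p` components in which the vertices
of `D` lie in distinct components. -/
noncomputable def indepSum (w : ℕ → R) (p : ℕ) (D : Finset V) : R :=
  ∑ F ∈ spanningForests V with Indep F D ∧ D.card + p + excess F = Fintype.card V, weight w F

theorem indepSum_zero (w : ℕ → R) (D : Finset V) : indepSum w 0 D = rootedSum w D := by
  rw [indepSum, rootedSum]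
  congr 1
  exact Finset.filter_congr fun F hF => by rw [isRootSet_iff_card hF, add_zero]

/-- Marking a hyperedge of a hyperforest amounts to adding a hyperedge whose vertices lie in
distinct components of a hyperforest. -/
theorem sum_marked_edge (w : ℕ → R) (ψ : Finset V → R) (P : Finset (Finset V) → Finset V → Prop) :
    ∑ F ∈ spanningForests V, ∑ A ∈ F with P F A, ψ A * weight w F =
      ∑ F ∈ spanningForests V, ∑ A with 2 ≤ A.card ∧ Indep F A ∧ P (insert A F) A,
        ψ A * w A.card * weight w F := by
  rw [Finset.sum_sigma', Finset.sum_sigma']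
  refine Finset.sum_bij' (fun q _ => ⟨q.1.erase q.2, q.2⟩) (fun q _ => ⟨insert q.2 q.1, q.2⟩)
    ?_ ?_ ?_ ?_ ?_
  · rintro ⟨F, A⟩ h
    simp only [Finset.mem_sigma, Finset.mem_filter, Finset.mem_univ, true_and] at h ⊢
    obtain ⟨hF, hA, hP⟩ := h
    have := (insert_mem_spanningForests_iff (Finset.notMem_erase A F)).1
      (by rwa [Finset.insert_erase hA])
    rw [Finset.insert_erase hA]
    exact ⟨this.1, this.2.1, this.2.2, hP⟩
  · rintro ⟨F, A⟩ h
    simp only [Finset.mem_sigma, Finset.mem_filter, Finset.mem_univ, true_and] at h ⊢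
    obtain ⟨hF, hA, hI, hP⟩ := h
    exact ⟨(insert_mem_spanningForests_iff (hI.notMem_of_two_le_card hA)).2 ⟨hF, hA, hI⟩,
      Finset.mem_insert_self _ _, hP⟩
  · rintro ⟨F, A⟩ h
    simp only [Finset.mem_sigma, Finset.mem_filter] at h
    simp [Finset.insert_erase h.2.1]
  · rintro ⟨F, A⟩ h
    simp only [Finset.mem_sigma, Finset.mem_filter, Finset.mem_univ, true_and] at h
    simp [Finset.erase_insert (h.2.2.1.notMem_of_two_le_card h.2.1)]
  · rintro ⟨F, A⟩ h
    simp only [Finset.mem_sigma, Finset.mem_filter] at h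
    simp only [weight]
    rw [← Finset.mul_prod_erase F _ h.2.1]
    ring

/-- Subtracting `card_reaches` from the total vertex count leaves the vertices and hyperedges of the
`q` components that miss `D`. -/
theorem natCast_eq_card_sub_sum {F : Finset (Finset V)} (hF : F ∈ spanningForests V)
    {D : Finset V} (hD : Indep F D) {q : ℕ} (hq : D.card + q + excess F = Fintype.card V) :
    (q : R) = ((Finset.univ.filter fun v => ¬ Reaches F D v).card : R) -
      ∑ A ∈ F with ¬ ∃ a ∈ A, Reaches F D a, ((A.card - 1 : ℕ) : R) := by
  have h1 := card_reaches (mem_spanningForests.1 hF).2 (nonempty_of_mem_spanningForests hF) hD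
  have h2 := Finset.card_filter_add_card_filter_not (s := (Finset.univ : Finset V)) (Reaches F D)
  have h3 : _ = excess F := Finset.sum_filter_add_sum_filter_not F
    (fun A => ∃ a ∈ A, Reaches F D a) (fun A => A.card - 1)
  rw [Finset.card_univ] at h2
  rw [eq_sub_iff_add_eq, ← Nat.cast_sum, ← Nat.cast_add]
  congr 1
  omega

theorem sum_not_reaches (w : ℕ → R) (p : ℕ) (D : Finset V) :
    ∑ F ∈ spanningForests V with Indep F D ∧ D.card + (p + 1) + excess F = Fintype.card V,
      ((Finset.univ.filter fun v => ¬ Reaches F D v).card : R) * weight w F =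
    ∑ v with v ∉ D, indepSum w p (insert v D) := by
  simp only [indepSum, ← nsmul_eq_mul, ← Finset.sum_const]
  refine Finset.sum_comm' fun F v => ?_
  simp only [Finset.mem_filter, Finset.mem_univ, true_and]
  constructor
  · rintro ⟨⟨hF, hD, hc⟩, hv⟩
    have hvD : v ∉ D := fun h => hv ⟨v, h, Joined.rfl⟩
    refine ⟨⟨hF, (indep_insert_iff hvD).2 ⟨hD, hv⟩, ?_⟩, hvD⟩
    rw [Finset.card_insert_of_notMem hvD]
    omega
  · rintro ⟨⟨hF, hD, hc⟩, hvD⟩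
    rw [Finset.card_insert_of_notMem hvD] at hc
    obtain ⟨h1, h2⟩ := (indep_insert_iff hvD).1 hD
    exact ⟨⟨hF, h1, by omega⟩, h2⟩

/-- Deleting the marked hyperedge lowers `excess` by `|A| - 1` while the independent set gains `|A|`
elements, so `p + 1` drops to `p`. -/
theorem sum_edges_not_reached (w : ℕ → R) (p : ℕ) (D : Finset V) :
    ∑ F ∈ spanningForests V with Indep F D ∧ D.card + (p + 1) + excess F = Fintype.card V,
      (∑ A ∈ F with ¬ ∃ a ∈ A, Reaches F D a, ((A.card - 1 : ℕ) : R)) * weight w F =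
    ∑ A with Disjoint A D, ((A.card - 1 : ℕ) : R) * w A.card * indepSum w p (A ∪ D) := by
  have h := sum_marked_edge w (fun A : Finset V => ((A.card - 1 : ℕ) : R)) (fun F A =>
    (Indep F D ∧ D.card + (p + 1) + excess F = Fintype.card V) ∧ ¬ ∃ a ∈ A, Reaches F D a)
  -- The truncated factor `|A| - 1` kills the sets with fewer than two elements.
  have h2 : ∑ A with Disjoint A D, ((A.card - 1 : ℕ) : R) * w A.card * indepSum w p (A ∪ D) =
      ∑ A with Disjoint A D ∧ 2 ≤ A.card,
        ((A.card - 1 : ℕ) : R) * w A.card * indepSum w p (A ∪ D) := by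
    rw [← Finset.filter_filter]
    refine (Finset.sum_filter_of_ne fun A _ hA => ?_).symm
    by_contra hlt
    exact hA (by rw [show A.card - 1 = 0 by omega]; simp)
  rw [h2]
  simp only [indepSum, Finset.mul_sum]
  rw [Finset.sum_filter]
  refine Eq.trans (Finset.sum_congr rfl fun F _ => ?_) (h.trans (Finset.sum_comm' fun F A => ?_))
  · split_ifs with hc
    · rw [Finset.sum_mul]
      refine Finset.sum_congr ?_ fun _ _ => rfl
      ext A
      simp only [Finset.mem_filter, hc, true_and, and_self]
    · refine (Finset.sum_eq_zero fun A hA => ?_).symm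
      simp only [Finset.mem_filter] at hA
      exact absurd hA.2.1 hc
  · simp only [Finset.mem_filter, Finset.mem_univ, true_and]
    have key : ∀ hA : 2 ≤ A.card, Indep F A →
        excess (insert A F) = (A.card - 1) + excess F := fun hA hI => by
      rw [excess, Finset.sum_insert (hI.notMem_of_two_le_card hA), excess]
    constructor
    · rintro ⟨hF, hA, hI, ⟨hD, hc⟩, hr⟩
      obtain ⟨hd, hAD⟩ := indep_insert_and_not_reaches_iff.1 ⟨hI, hD, hr⟩
      rw [key hA hI] at hc
      refine ⟨⟨hF, hAD, ?_⟩, hd, hA⟩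
      rw [Finset.card_union_of_disjoint hd]
      omega
    · rintro ⟨⟨hF, hAD, hc⟩, hd, hA⟩
      obtain ⟨hI, hD, hr⟩ := indep_insert_and_not_reaches_iff.2 ⟨hd, hAD⟩
      rw [Finset.card_union_of_disjoint hd] at hc
      refine ⟨hF, hA, hI, ⟨hD, ?_⟩, hr⟩
      rw [key hA hI]
      omega

/-- Weighs each hyperforest by its `p + 1` components missing `D`. Marked vertices appear as
singletons of weight `1`, marked hyperedges with weight `-(|A| - 1) w`; `kWeight` is the sum of the
two. -/
theorem natCast_succ_mul_indepSum [CharZero R] (w : ℕ → R) (p : ℕ) (D : Finset V) :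
    ((p : R) + 1) * indepSum w (p + 1) D =
      ∑ A with Disjoint A D, kWeight w A.card * indepSum w p (A ∪ D) := by
  have hk : ∀ j : ℕ, kWeight w j = (if j = 1 then 1 else 0) - ((j - 1 : ℕ) : R) * w j := by
    intro j
    rcases Nat.eq_zero_or_pos j with rfl | hj
    · simp [kWeight_zero]
    · rw [kWeight_of_pos w hj, Nat.cast_sub hj]
      push_cast
      ring
  have hs : ∑ v with v ∉ D, indepSum w p (insert v D) =
      ∑ A with Disjoint A D, (if A.card = 1 then 1 else 0) * indepSum w p (A ∪ D) := by
    simp only [ite_mul, one_mul, zero_mul]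
    rw [← Finset.sum_filter, Finset.filter_filter]
    refine Finset.sum_bij (fun v _ => {v}) ?_ ?_ ?_ ?_
    · intro v hv
      simpa using hv
    · intro a _ b _ h
      simpa using h
    · intro A hA
      simp only [Finset.mem_filter, Finset.mem_univ, true_and] at hA
      obtain ⟨v, rfl⟩ := Finset.card_eq_one.1 hA.2
      exact ⟨v, by simpa using hA.1, rfl⟩
    · intro v _
      rfl
  simp only [hk, sub_mul, Finset.sum_sub_distrib]
  rw [← hs, ← sum_edges_not_reached, ← sum_not_reaches, ← Finset.sum_sub_distrib, indepSum,
    Finset.mul_sum]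
  refine Finset.sum_congr rfl fun F hF => ?_
  obtain ⟨hF, hD, hc⟩ := Finset.mem_filter.1 hF
  rw [← sub_mul, ← natCast_eq_card_sub_sum hF hD hc]
  push_cast
  rfl

/-- Both sides obey one recursion in `p`: for fixed `S`, the sets `A` range over the subsets of `S \
D`, and the binomials in `coeff_polyPi_succ` count them by size. At `p = 0` only `S = D` survives.
-/
theorem indepSum_eq_sum_polyPi [CharZero R] (w : ℕ → R) (p : ℕ) (D : Finset V) :
    indepSum w p D = ∑ S with D ⊆ S, (polyPi (S.card - D.card) w).coeff p * rootedSum w S := by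
  induction p generalizing D with
  | zero =>
    rw [indepSum_zero, Finset.sum_eq_single D]
    · simp [coeff_polyPi_zero_right]
    · intro S hS hne
      have hDS := (Finset.mem_filter.1 hS).2
      have := Finset.card_lt_card (Finset.ssubset_iff_subset_ne.2 ⟨hDS, hne.symm⟩)
      rw [coeff_polyPi_zero_right, if_neg (by omega), zero_mul]
    · intro h
      simp at h
  | succ p ih =>
    have hp : (p : R) + 1 ≠ 0 := by exact_mod_cast p.succ_ne_zero
    refine mul_left_cancel₀ hp ?_
    rw [natCast_succ_mul_indepSum, Finset.mul_sum]
    simp only [ih, Finset.mul_sum]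
    rw [Finset.sum_comm' (t' := Finset.univ.filter fun S => D ⊆ S)
      (s' := fun S => (S \ D).powerset)]
    · refine Finset.sum_congr rfl fun S hS => ?_
      have hDS := (Finset.mem_filter.1 hS).2
      rw [← mul_assoc, coeff_polyPi_succ, ← Finset.card_sdiff_of_subset hDS, Finset.sum_mul]
      have h := Finset.sum_powerset_apply_card (fun j =>
        kWeight w j * (polyPi ((S \ D).card - j) w).coeff p * rootedSum w S) (x := S \ D)
      simp only [nsmul_eq_mul] at h
      refine (Finset.sum_congr rfl fun A hA => ?_).trans
        (h.trans (Finset.sum_congr rfl fun j _ => by ring))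
      have hA' := Finset.mem_powerset.1 hA
      have hd : Disjoint A D := Finset.disjoint_of_subset_left hA' Finset.sdiff_disjoint
      rw [Finset.card_union_of_disjoint hd, Finset.card_sdiff_of_subset hDS,
        Nat.add_comm A.card, Nat.sub_add_eq, mul_assoc]
    · intro A S
      simp only [Finset.mem_filter, Finset.mem_univ, true_and, Finset.mem_powerset,
        Finset.subset_sdiff, Finset.union_subset_iff]
      tauto

end ForestSums
end Hyperforest

namespace Hyperforest

/-! ### Invariance under permutations of the vertices. -/

section Relabel

variable {V : Type*}

/-- The action of a permutation of the vertices on sets of hyperedges. -/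
def relabel (σ : V ≃ V) : Finset (Finset V) ≃ Finset (Finset V) :=
  σ.finsetCongr.finsetCongr

theorem map_mem_relabel {σ : V ≃ V} {F : Finset (Finset V)} {A : Finset V} :
    A.map σ.toEmbedding ∈ relabel σ F ↔ A ∈ F := by
  simp only [relabel, Equiv.finsetCongr_apply]
  exact Finset.mem_map' σ.finsetCongr.toEmbedding

theorem forall_mem_relabel {σ : V ≃ V} {F : Finset (Finset V)} {P : Finset V → Prop} :
    (∀ B ∈ relabel σ F, P B) ↔ ∀ A ∈ F, P (A.map σ.toEmbedding) := by
  simp only [relabel, Equiv.finsetCongr_apply, Finset.forall_mem_map]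
  rfl

theorem Joined.relabel {F : Finset (Finset V)} {u v : V} (σ : V ≃ V) (h : Joined F u v) :
    Joined (relabel σ F) (σ u) (σ v) := by
  induction h with
  | refl => exact Joined.rfl
  | tail _ hbc ih =>
    obtain ⟨A, hA, hb, hc⟩ := hbc
    exact ih.trans (joined_of_mem (map_mem_relabel.2 hA) (Finset.mem_map_of_mem _ hb)
      (Finset.mem_map_of_mem _ hc))

theorem relabel_symm_relabel (σ : V ≃ V) (F : Finset (Finset V)) :
    relabel σ.symm (relabel σ F) = F := by
  ext A
  have h := map_mem_relabel (σ := σ.symm) (F := relabel σ F) (A := A.map σ.toEmbedding)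
  have : (A.map σ.toEmbedding).map σ.symm.toEmbedding = A := by
    ext x
    simp
  rw [this] at h
  exact h.trans map_mem_relabel

theorem joined_relabel_iff {σ : V ≃ V} {F : Finset (Finset V)} {u v : V} :
    Joined (relabel σ F) (σ u) (σ v) ↔ Joined F u v := by
  refine ⟨fun h => ?_, fun h => h.relabel σ⟩
  simpa [relabel_symm_relabel] using h.relabel σ.symm

theorem indep_relabel_iff {σ : V ≃ V} {F : Finset (Finset V)} {D : Finset V} :
    Indep (relabel σ F) (D.map σ.toEmbedding) ↔ Indep F D := by
  simp only [Indep, Finset.forall_mem_map, Equiv.coe_toEmbedding, joined_relabel_iff,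
    EmbeddingLike.apply_eq_iff_eq]

theorem isRootSet_relabel_iff {σ : V ≃ V} {F : Finset (Finset V)} {S : Finset V} :
    IsRootSet (relabel σ F) (S.map σ.toEmbedding) ↔ IsRootSet F S := by
  rw [isRootSet_iff, isRootSet_iff, indep_relabel_iff, σ.surjective.forall]
  simp only [Reaches, Finset.mem_map, exists_exists_and_eq_and, Equiv.coe_toEmbedding,
    joined_relabel_iff]

theorem weight_relabel {R : Type*} [Field R] (w : ℕ → R) (σ : V ≃ V) (F : Finset (Finset V)) :
    weight w (relabel σ F) = weight w F := by
  simp [weight, relabel]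

variable [DecidableEq V]

theorem acyclic_relabel_iff {σ : V ≃ V} {F : Finset (Finset V)} :
    Acyclic (relabel σ F) ↔ Acyclic F := by
  rw [Acyclic, forall_mem_relabel]
  refine forall₂_congr fun A _ => ?_
  have : (relabel σ F).erase (A.map σ.toEmbedding) = relabel σ (F.erase A) := by
    simp only [relabel, Equiv.finsetCongr_apply]
    exact (Finset.map_erase σ.finsetCongr.toEmbedding F A).symm
  rw [this, indep_relabel_iff]

theorem relabel_mem_spanningForests_iff [Fintype V] {σ : V ≃ V} {F : Finset (Finset V)} :
    relabel σ F ∈ spanningForests V ↔ F ∈ spanningForests V := by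
  rw [mem_spanningForests, mem_spanningForests, acyclic_relabel_iff, forall_mem_relabel]
  simp

end Relabel

/-! ### Rooted sums: the recursion on the number of non-root vertices. -/

section RootedSums

open scoped Classical

variable {V : Type*} [Fintype V] [DecidableEq V] {R : Type*} [Field R]

/-- The sum of the weights of the hyperforests with root set `S` and a marked vertex in the
component of `r`. -/
noncomputable def pointedSum (w : ℕ → R) (S : Finset V) (r : V) : R :=
  ∑ F ∈ spanningForests V with IsRootSet F S,
    ((Finset.univ.filter fun x => Joined F r x).card : R) * weight w F

/-- The transposition of the two roots preserves `S` and exchanges their components. -/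
theorem pointedSum_eq_of_mem (w : ℕ → R) {S : Finset V} {r t : V} (hr : r ∈ S) (ht : t ∈ S) :
    pointedSum w S r = pointedSum w S t := by
  set σ := Equiv.swap r t
  have hS : S.map σ.toEmbedding = S := by
    refine Finset.eq_of_subset_of_card_le (fun x hx => ?_) (by simp)
    obtain ⟨y, hy, rfl⟩ := Finset.mem_map.1 hx
    simp only [Equiv.coe_toEmbedding, σ, Equiv.swap_apply_def]
    split_ifs <;> assumption
  refine Finset.sum_equiv (relabel σ) (fun F => ?_) fun F _ => ?_
  · rw [Finset.mem_filter, Finset.mem_filter, relabel_mem_spanningForests_iff]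
    nth_rewrite 2 [← hS]
    rw [isRootSet_relabel_iff]
  · rw [weight_relabel]
    congr 2
    refine Finset.card_equiv σ fun x => ?_
    simp only [Finset.mem_filter, Finset.mem_univ, true_and]
    rw [← joined_relabel_iff (σ := σ), show σ r = t from Equiv.swap_apply_left r t]

theorem sum_card_joined {F : Finset (Finset V)} {S T : Finset V} (hS : Indep F S) (hT : T ⊆ S) :
    ∑ r ∈ T, (Finset.univ.filter fun x => Joined F r x).card =
      (Finset.univ.filter (Reaches F T)).card := by
  rw [← Finset.card_biUnion]
  · congr 1
    ext x
    simp [Reaches]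
  · intro r hr t ht hne
    refine Finset.disjoint_left.2 fun x hx hx' => hne ?_
    simp only [Finset.mem_filter, Finset.mem_univ, true_and] at hx hx'
    exact hS (hT hr) (hT ht) (hx.trans hx'.symm)

theorem sum_pointedSum (w : ℕ → R) {S T : Finset V} (hT : T ⊆ S) :
    ∑ r ∈ T, pointedSum w S r =
      ∑ F ∈ spanningForests V with IsRootSet F S,
        ((Finset.univ.filter (Reaches F T)).card : R) * weight w F := by
  simp only [pointedSum]
  rw [Finset.sum_comm]
  refine Finset.sum_congr rfl fun F hF => ?_
  rw [← sum_card_joined (isRootSet_iff.1 (Finset.mem_filter.1 hF).2).1 hT, Nat.cast_sum,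
    Finset.sum_mul]

/-- All roots of `S` have equal `pointedSum`, and together their components cover every vertex. -/
theorem card_mul_sum_pointedSum (w : ℕ → R) {S T : Finset V} (hT : T ⊆ S) :
    (S.card : R) * ∑ r ∈ T, pointedSum w S r =
      (T.card : R) * ((Fintype.card V : R) * rootedSum w S) := by
  rcases S.eq_empty_or_nonempty with rfl | ⟨t, ht⟩
  · simp [Finset.subset_empty.1 hT]
  · have h : ∀ U ⊆ S, ∑ r ∈ U, pointedSum w S r = (U.card : R) * pointedSum w S t := by
      intro U hU
      rw [Finset.sum_congr rfl fun r hr => pointedSum_eq_of_mem w (hU hr) ht, Finset.sum_const,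
        nsmul_eq_mul]
    have hall : ∑ r ∈ S, pointedSum w S r = (Fintype.card V : R) * rootedSum w S := by
      rw [sum_pointedSum w subset_rfl, rootedSum, Finset.mul_sum]
      refine Finset.sum_congr rfl fun F hF => ?_
      rw [Finset.filter_true_of_mem fun v _ => (isRootSet_iff.1 (Finset.mem_filter.1 hF).2).2 v,
        Finset.card_univ]
    rw [← hall, h S subset_rfl, h T hT]
    ring

/-- Splits `A` into its attachment vertex `x`, reached from `S` without `A`, and the rest `B`. By
`attach_iff`, `B` is then a set of additional roots and `x` ranges freely over the reached vertices.
-/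
theorem sum_attached_edges (φ : ℕ → R) (F : Finset (Finset V)) (S : Finset V) :
    ∑ A with 2 ≤ A.card ∧ Indep F A ∧ IsRootSet (insert A F) S, φ (A.card - 1) =
      ∑ B with 1 ≤ B.card ∧ Disjoint B S ∧ IsRootSet F (S ∪ B),
        φ B.card * ((Finset.univ.filter (Reaches F S)).card : R) := by
  have h1 : ∀ A : Finset V, A ∈ Finset.univ.filter (fun A : Finset V =>
      2 ≤ A.card ∧ Indep F A ∧ IsRootSet (insert A F) S) →
      φ (A.card - 1) = ∑ x ∈ A with Reaches F S x, φ (A.card - 1) := by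
    intro A hA
    obtain ⟨hA, hI, hS⟩ := (Finset.mem_filter.1 hA).2
    rw [Finset.sum_const, card_reached_vertices (Finset.card_pos.1 (by omega)) hI hS, one_smul]
  rw [Finset.sum_congr rfl h1]
  simp only [mul_comm (φ _), ← nsmul_eq_mul, ← Finset.sum_const]
  rw [Finset.sum_sigma', Finset.sum_sigma']
  refine Finset.sum_bij' (fun q _ => ⟨q.1.erase q.2, q.2⟩) (fun q _ => ⟨insert q.2 q.1, q.2⟩)
    ?_ ?_ ?_ ?_ ?_
  · rintro ⟨A, x⟩ h
    simp only [Finset.mem_sigma, Finset.mem_filter, Finset.mem_univ, true_and] at h ⊢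
    obtain ⟨⟨hA, hI, hS⟩, hxA, hx⟩ := h
    have := (attach_iff (B := A.erase x) hx).1
      ⟨Finset.notMem_erase x A, by rwa [Finset.insert_erase hxA], by rwa [Finset.insert_erase hxA]⟩
    rw [Finset.card_erase_of_mem hxA]
    exact ⟨⟨by omega, this⟩, hx⟩
  · rintro ⟨B, x⟩ h
    simp only [Finset.mem_sigma, Finset.mem_filter, Finset.mem_univ, true_and] at h ⊢
    obtain ⟨⟨hB, h⟩, hx⟩ := h
    obtain ⟨hxB, h⟩ := (attach_iff hx).2 h
    rw [Finset.card_insert_of_notMem hxB]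
    exact ⟨⟨by omega, h⟩, Finset.mem_insert_self _ _, hx⟩
  · rintro ⟨A, x⟩ h
    simp only [Finset.mem_sigma, Finset.mem_filter] at h
    simp [Finset.insert_erase h.2.1]
  · rintro ⟨B, x⟩ h
    simp only [Finset.mem_sigma, Finset.mem_filter, Finset.mem_univ, true_and] at h
    simp [Finset.erase_insert ((attach_iff h.2).2 h.1.2).1]
  · rintro ⟨A, x⟩ h
    simp only [Finset.mem_sigma, Finset.mem_filter] at h
    simp only [Finset.card_erase_of_mem h.2.1]

/-- Here `m` equals `excess F`, so the left side marks a hyperedge with multiplicity `|A| - 1 =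
|B|`, which is then detached. -/
theorem natCast_mul_rootedSum (w : ℕ → R) {S : Finset V} {m : ℕ}
    (hm : S.card + m = Fintype.card V) :
    (m : R) * rootedSum w S =
      ∑ B with Disjoint B S,
        (B.card : R) * w (B.card + 1) * ∑ r ∈ S, pointedSum w (S ∪ B) r := by
  have h1 : (m : R) * rootedSum w S =
      ∑ F ∈ spanningForests V, ∑ A ∈ F with IsRootSet F S,
        ((A.card - 1 : ℕ) : R) * weight w F := by
    rw [rootedSum, Finset.mul_sum, Finset.sum_filter]
    refine Finset.sum_congr rfl fun F hF => ?_
    split_ifs with h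
    · have := h.card_add_excess (mem_spanningForests.1 hF).2 (nonempty_of_mem_spanningForests hF)
      rw [Finset.filter_true_of_mem fun _ _ => h, ← Finset.sum_mul, ← Nat.cast_sum,
        show m = excess F by omega, excess]
    · rw [Finset.filter_false_of_mem fun _ _ => h, Finset.sum_empty]
  rw [h1, sum_marked_edge w (fun A : Finset V => ((A.card - 1 : ℕ) : R))
    (fun F _ => IsRootSet F S)]
  have h2 : ∀ F ∈ spanningForests V,
      ∑ A with 2 ≤ A.card ∧ Indep F A ∧ IsRootSet (insert A F) S,
        ((A.card - 1 : ℕ) : R) * w A.card * weight w F =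
      ∑ B with 1 ≤ B.card ∧ Disjoint B S ∧ IsRootSet F (S ∪ B),
        (B.card : R) * w (B.card + 1) * (((Finset.univ.filter (Reaches F S)).card : R) *
          weight w F) := by
    intro F _
    have h := sum_attached_edges (fun j => (j : R) * w (j + 1)) F S
    simp only [← mul_assoc]
    rw [← Finset.sum_mul, ← Finset.sum_mul, ← h]
    congr 1
    refine Finset.sum_congr rfl fun A hA => ?_
    have := (Finset.mem_filter.1 hA).2.1
    rw [show A.card - 1 + 1 = A.card by omega]
  have h3 : ∑ B with Disjoint B S,
        (B.card : R) * w (B.card + 1) * ∑ r ∈ S, pointedSum w (S ∪ B) r =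
      ∑ B with Disjoint B S ∧ 1 ≤ B.card,
        (B.card : R) * w (B.card + 1) * ∑ r ∈ S, pointedSum w (S ∪ B) r := by
    rw [← Finset.filter_filter]
    refine (Finset.sum_filter_of_ne fun B _ hB => ?_).symm
    by_contra hlt
    exact hB (by rw [show B.card = 0 by omega]; simp)
  rw [Finset.sum_congr rfl h2, h3]
  simp only [sum_pointedSum w (Finset.subset_union_left : S ⊆ S ∪ _), Finset.mul_sum]
  refine Finset.sum_comm' fun F B => ?_
  simp only [Finset.mem_filter, Finset.mem_univ, true_and]
  tauto

theorem rootedSum_univ (w : ℕ → R) : rootedSum w (Finset.univ : Finset V) = 1 := by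
  rw [rootedSum, Finset.sum_eq_single ∅]
  · simp [weight]
  · intro F hF hne
    obtain ⟨hF, hS⟩ := Finset.mem_filter.1 hF
    obtain ⟨A, hA⟩ := Finset.nonempty_iff_ne_empty.2 hne
    exact absurd hA (((isRootSet_iff.1 hS).1.anti_right (Finset.subset_univ A)).notMem_of_two_le_card
      ((mem_spanningForests.1 hF).1 A hA))
  · intro h
    refine absurd (Finset.mem_filter.2 ⟨mem_spanningForests.2 ⟨by simp, by simp [Acyclic]⟩, ?_⟩) h
    have hE : (∅ : Finset (Finset V)) ∈ spanningForests V :=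
      mem_spanningForests.2 ⟨by simp, by simp [Acyclic]⟩
    refine (isRootSet_iff_card hE).2 ⟨fun u _ v _ huv => ?_, by simp [excess]⟩
    rcases Relation.ReflTransGen.cases_tail huv with h | ⟨c, _, B, hB, _⟩
    · exact h.symm
    · simp at hB

/-- The hyperforests with a given root set of cardinality `s` on `n` vertices have total weight
`(s / n) P_{n-s}(n)`. -/
theorem card_mul_rootedSum [CharZero R] (w : ℕ → R) (m : ℕ) {S : Finset V}
    (hm : S.card + m = Fintype.card V) (hS : S.Nonempty) :
    (Fintype.card V : R) * rootedSum w S =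
      (S.card : R) * (polyP m w).eval (Fintype.card V : R) := by
  induction m using Nat.strong_induction_on generalizing S with
  | _ m ih =>
    rcases Nat.eq_zero_or_pos m with rfl | hpos
    · have : S = Finset.univ := (Finset.card_eq_iff_eq_univ S).1 (by omega)
      subst this
      simp [rootedSum_univ, polyP_zero]
    · have hm0 : (m : R) ≠ 0 := by exact_mod_cast hpos.ne'
      refine mul_left_cancel₀ hm0 ?_
      have hsum : ∀ B ∈ Finset.univ.filter (fun B => Disjoint B S),
          (B.card : R) * w (B.card + 1) * ∑ r ∈ S, pointedSum w (S ∪ B) r =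
          (S.card : R) * ((B.card : R) * w (B.card + 1) *
            (polyP (m - B.card) w).eval (Fintype.card V : R)) := by
        intro B hB
        have hd := (Finset.mem_filter.1 hB).2
        -- For empty `B` the induction hypothesis is unavailable, but the factor `|B|` makes both
        -- sides vanish.
        rcases Nat.eq_zero_or_pos B.card with hB0 | hBpos
        · simp [hB0]
        · have hcard : (S ∪ B).card = S.card + B.card := Finset.card_union_of_disjoint hd.symm
          have hle := Finset.card_le_univ (S ∪ B)
          have hne : ((S ∪ B).card : R) ≠ 0 := by
            exact_mod_cast (by omega : (S ∪ B).card ≠ 0)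
          have h := card_mul_sum_pointedSum w (Finset.subset_union_left : S ⊆ S ∪ B)
          rw [ih (m - B.card) (by omega) (by omega) (hS.mono Finset.subset_union_left),
            mul_left_comm] at h
          rw [mul_left_cancel₀ hne h]
          ring
      have hfil : Finset.univ.filter (fun B => Disjoint B S) = Sᶜ.powerset := by
        ext B
        simp [le_compl_iff_disjoint_right]
      have hpow := Finset.sum_powerset_apply_card (fun j => (j : R) * w (j + 1) *
        (polyP (m - j) w).eval (Fintype.card V : R)) (x := Sᶜ)
      rw [Finset.card_compl, show Fintype.card V - S.card = m by omega] at hpow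
      rw [mul_left_comm, natCast_mul_rootedSum w hm, Finset.sum_congr rfl hsum, ← Finset.mul_sum,
        hfil, hpow, mul_left_comm (m : R), natCast_mul_eval_polyP]
      simp only [nsmul_eq_mul]
      ring

end RootedSums
end Hyperforest

namespace Hyperforest

/-! ### Specialization to the complete hypergraph. -/

section CompleteHypergraph

open scoped Classical

theorem hyperforests_eq_spanningForests (n : ℕ) : hyperforests n = spanningForests (Fin n) := by
  ext F
  simp [hyperforests, completeEdges, mem_spanningForests, isHyperforest_iff_acyclic,
    Finset.subset_iff]

variable {R : Type*} [Field R]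

theorem unrootedWeight_eq_indepSum (n p : ℕ) (w : ℕ → R) :
    unrootedWeight n p w = indepSum w p (∅ : Finset (Fin n)) := by
  rw [unrootedWeight, indepSum, hyperforests_eq_spanningForests]
  refine Finset.sum_congr ?_ fun _ _ => rfl
  ext F
  simp only [Finset.mem_filter, Finset.card_empty, zero_add]
  refine and_congr_right fun hF => ?_
  have h := numComponents_add_excess hF
  refine ⟨fun hp => ⟨fun u hu => absurd hu (Finset.notMem_empty u), by omega⟩, fun hp => ?_⟩
  have := hp.2
  omega

theorem rootedWeight_eq_sum_rootedSum (n s : ℕ) (w : ℕ → R) :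
    rootedWeight n s w = ∑ S : Finset (Fin n) with S.card = s, rootedSum w S := by
  simp only [rootedWeight, rootedSum, hyperforests_eq_spanningForests]
  refine Finset.sum_comm' fun F S => ?_
  simp only [Finset.mem_filter, Finset.mem_univ, true_and]
  constructor
  · rintro ⟨⟨hF, hs⟩, hS⟩
    exact ⟨⟨hF, hS⟩, hS.card_eq_numComponents.trans hs⟩
  · rintro ⟨⟨hF, hS⟩, hs⟩
    exact ⟨⟨hF, hS.card_eq_numComponents.symm.trans hs⟩, hS⟩

theorem rootedSum_empty {V : Type*} [Fintype V] [DecidableEq V] [Nonempty V] (w : ℕ → R) :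
    rootedSum w (∅ : Finset V) = 0 := by
  refine Finset.sum_eq_zero fun F hF => ?_
  obtain ⟨r, ⟨hr, _⟩, _⟩ := (Finset.mem_filter.1 hF).2 (Classical.arbitrary V)
  exact absurd hr (Finset.notMem_empty r)

theorem unrootedGF_eq_sum (n : ℕ) (w : ℕ → R) (lam : R) :
    unrootedGF n w lam = ∑ p ∈ Finset.range (n + 1), unrootedWeight n p w * lam ^ p := by
  rw [unrootedGF, ← Finset.sum_fiberwise_of_maps_to (g := numComponents)
    (t := Finset.range (n + 1))]
  · refine Finset.sum_congr rfl fun p _ => ?_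
    rw [unrootedWeight, Finset.sum_mul]
    refine Finset.sum_congr rfl fun F hF => ?_
    rw [(Finset.mem_filter.1 hF).2]
  · intro F hF
    rw [hyperforests_eq_spanningForests] at hF
    have := numComponents_add_excess hF
    rw [Fintype.card_fin] at this
    exact Finset.mem_range.2 (by omega)

theorem numComponents_eq_one_iff {n : ℕ} {F : Finset (Finset (Fin n))}
    (hF : F ∈ spanningForests (Fin n)) (r : Fin n) :
    numComponents F = 1 ↔ IsRootSet F {r} := by
  have h := numComponents_add_excess hF
  rw [isRootSet_iff_card hF, Finset.card_singleton]
  refine ⟨fun h1 => ⟨fun u hu v hv _ => ?_, by omega⟩, fun h1 => ?_⟩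
  · rw [Finset.mem_singleton.1 hu, Finset.mem_singleton.1 hv]
  · have := h1.2
    omega

theorem hypertreeWeight_eq_unrootedWeight_one {n : ℕ} (hn : 1 ≤ n) (w : ℕ → R) :
    hypertreeWeight n w = unrootedWeight n 1 w := by
  rw [hypertreeWeight, unrootedWeight]
  refine Finset.sum_congr ?_ fun _ _ => rfl
  ext F
  have hsplit : F ∈ hypertrees n ↔ F ∈ hyperforests n ∧ ∀ u v, Joined F u v := by
    simp only [hypertrees, hyperforests, Finset.mem_filter, IsHypertree, and_assoc]
  rw [hsplit, Finset.mem_filter]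
  refine and_congr_right fun hF => ?_
  rw [hyperforests_eq_spanningForests] at hF
  let r : Fin n := ⟨0, hn⟩
  rw [numComponents_eq_one_iff hF r, isRootSet_iff]
  constructor
  · refine fun h => ⟨fun u hu v hv _ => ?_, fun v => ⟨r, Finset.mem_singleton_self r, h r v⟩⟩
    rw [Finset.mem_singleton.1 hu, Finset.mem_singleton.1 hv]
  · rintro ⟨_, h⟩ u v
    obtain ⟨a, ha, hau⟩ := h u
    obtain ⟨b, hb, hbv⟩ := h v
    rw [Finset.mem_singleton.1 ha] at hau
    rw [Finset.mem_singleton.1 hb] at hbv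
    exact hau.symm.trans hbv

/-- Each of the `n` vertices can be the root of a given hypertree. -/
theorem rootedWeight_one (n : ℕ) (w : ℕ → R) :
    rootedWeight n 1 w = (n : R) * unrootedWeight n 1 w := by
  have h : ∀ S ∈ Finset.univ.filter (fun S : Finset (Fin n) => S.card = 1),
      rootedSum w S = unrootedWeight n 1 w := by
    intro S hS
    obtain ⟨r, rfl⟩ := Finset.card_eq_one.1 (Finset.mem_filter.1 hS).2
    rw [rootedSum, unrootedWeight, hyperforests_eq_spanningForests]
    refine Finset.sum_congr ?_ fun _ _ => rfl
    ext F
    simp only [Finset.mem_filter]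
    exact and_congr_right fun hF => (numComponents_eq_one_iff hF r).symm
  rw [rootedWeight_eq_sum_rootedSum, Finset.sum_congr rfl h, Finset.sum_const,
    Finset.univ_filter_card_eq, Finset.card_powersetCard, Finset.card_univ, Fintype.card_fin,
    Nat.choose_one_right, nsmul_eq_mul]

variable [CharZero R]

theorem rootedWeight_eq_choose_mul {n s : ℕ} (hs : s ∈ Finset.Icc 1 n) (w : ℕ → R) :
    rootedWeight n s w = ((n - 1).choose (s - 1) : R) * (polyP (n - s) w).eval (n : R) := by
  obtain ⟨h1, h2⟩ := Finset.mem_Icc.1 hs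
  have hn : (n : R) ≠ 0 := by exact_mod_cast (by omega : n ≠ 0)
  refine mul_left_cancel₀ hn ?_
  have h : ∀ S ∈ Finset.univ.filter (fun S : Finset (Fin n) => S.card = s),
      (n : R) * rootedSum w S = (s : R) * (polyP (n - s) w).eval (n : R) := by
    intro S hS
    have hc := (Finset.mem_filter.1 hS).2
    have := card_mul_rootedSum w (n - s) (S := S) (by rw [Fintype.card_fin]; omega)
      (Finset.card_pos.1 (by omega))
    rwa [Fintype.card_fin, hc] at this
  rw [rootedWeight_eq_sum_rootedSum, Finset.mul_sum, Finset.sum_congr rfl h, Finset.sum_const,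
    Finset.univ_filter_card_eq, Finset.card_powersetCard, Finset.card_univ, Fintype.card_fin,
    nsmul_eq_mul]
  -- Absorption: the `n.choose s` root sets, each carrying a factor `s`, produce `n` times the
  -- required binomial.
  have hch : n * (n - 1).choose (s - 1) = n.choose s * s := by
    have := Nat.add_one_mul_choose_eq (n - 1) (s - 1)
    rwa [Nat.sub_add_cancel (h1.trans h2), Nat.sub_add_cancel h1] at this
  rw [← mul_assoc, ← mul_assoc, ← Nat.cast_mul, ← Nat.cast_mul, hch]

/-- The case `D = ∅` of `indepSum_eq_sum_polyPi`, grouped by `|S|`; the empty root set drops out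
because there is a vertex. -/
theorem unrootedWeight_eq_sum_rootedWeight {n : ℕ} (hn : 1 ≤ n) (p : ℕ) (w : ℕ → R) :
    unrootedWeight n p w =
      ∑ s ∈ Finset.Icc 1 n, (polyPi s w).coeff p * rootedWeight n s w := by
  have : Nonempty (Fin n) := ⟨⟨0, hn⟩⟩
  have hne : ∑ S : Finset (Fin n), (polyPi S.card w).coeff p * rootedSum w S =
      ∑ S : Finset (Fin n) with S.Nonempty, (polyPi S.card w).coeff p * rootedSum w S := by
    refine (Finset.sum_filter_of_ne fun S _ hS => ?_).symm
    by_contra h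
    exact hS (by rw [Finset.not_nonempty_iff_eq_empty.1 h, rootedSum_empty, mul_zero])
  rw [unrootedWeight_eq_indepSum, indepSum_eq_sum_polyPi]
  simp only [Finset.empty_subset, Finset.filter_true, Finset.card_empty, Nat.sub_zero]
  rw [hne, ← Finset.sum_fiberwise_of_maps_to (g := Finset.card) (t := Finset.Icc 1 n)]
  · refine Finset.sum_congr rfl fun s hs => ?_
    rw [rootedWeight_eq_sum_rootedSum, Finset.mul_sum, Finset.filter_filter]
    refine Finset.sum_congr (Finset.filter_congr fun S _ => ?_) fun S hS => ?_
    · refine ⟨fun h => h.2, fun h => ⟨Finset.card_pos.1 ?_, h⟩⟩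
      have := (Finset.mem_Icc.1 hs).1
      omega
    · rw [(Finset.mem_filter.1 hS).2]
  · intro S hS
    have := Finset.card_le_univ S
    rw [Fintype.card_fin] at this
    exact Finset.mem_Icc.2 ⟨Finset.card_pos.2 (Finset.mem_filter.1 hS).2, this⟩

theorem unrootedGF_eq_sum_rootedWeight {n : ℕ} (hn : 1 ≤ n) (w : ℕ → R) (lam : R) :
    unrootedGF n w lam =
      ∑ s ∈ Finset.Icc 1 n, (polyPi s w).eval lam * rootedWeight n s w := by
  simp only [unrootedGF_eq_sum, unrootedWeight_eq_sum_rootedWeight hn, Finset.sum_mul]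
  rw [Finset.sum_comm]
  refine Finset.sum_congr rfl fun s hs => ?_
  have hs' := (Finset.mem_Icc.1 hs).2
  rw [Polynomial.eval_eq_sum_range' (n := n + 1)
    (lt_of_le_of_lt (natDegree_polyPi_le w s) (by omega)), Finset.sum_mul]
  exact Finset.sum_congr rfl fun p _ => by ring

end CompleteHypergraph

end Hyperforest

theorem mainTheorem2 {R : Type*} [Field R] [CharZero R] (n : ℕ) (hn : 1 ≤ n) (w : ℕ → R) :
    (∀ lam : R,
      Hyperforest.unrootedGF n w lam =
          ∑ p ∈ Finset.range (n + 1), Hyperforest.unrootedWeight n p w * lam ^ p ∧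
      Hyperforest.unrootedGF n w lam =
          ∑ s ∈ Finset.Icc 1 n,
            (Hyperforest.polyPi s w).eval lam * Hyperforest.rootedWeight n s w ∧
      Hyperforest.unrootedGF n w lam =
          ∑ s ∈ Finset.Icc 1 n,
            ((n - 1).choose (s - 1) : R) * (Hyperforest.polyPi s w).eval lam *
              (Hyperforest.polyP (n - s) w).eval (n : R)) ∧
    (∀ p : ℕ,
      Hyperforest.unrootedWeight n p w =
          ∑ s ∈ Finset.Icc 1 n,
            (Hyperforest.polyPi s w).coeff p * Hyperforest.rootedWeight n s w ∧
      Hyperforest.unrootedWeight n p w =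
          ∑ s ∈ Finset.Icc 1 n,
            ((n - 1).choose (s - 1) : R) * (Hyperforest.polyPi s w).coeff p *
              (Hyperforest.polyP (n - s) w).eval (n : R)) ∧
    (Hyperforest.hypertreeWeight n w = Hyperforest.unrootedWeight n 1 w ∧
      Hyperforest.hypertreeWeight n w =
          (Hyperforest.polyP (n - 1) w).eval (n : R) / (n : R) ∧
      Hyperforest.hypertreeWeight n w = Hyperforest.rootedWeight n 1 w / (n : R)) := by
  have hroot : ∀ c : ℕ → R,
      ∑ s ∈ Finset.Icc 1 n, c s * Hyperforest.rootedWeight n s w =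
        ∑ s ∈ Finset.Icc 1 n, ((n - 1).choose (s - 1) : R) * c s *
          (Hyperforest.polyP (n - s) w).eval (n : R) := fun c =>
    Finset.sum_congr rfl fun s hs => by
      rw [Hyperforest.rootedWeight_eq_choose_mul hs]
      ring
  have hn0 : (n : R) ≠ 0 := by exact_mod_cast (by omega : n ≠ 0)
  have hone : Hyperforest.hypertreeWeight n w = Hyperforest.rootedWeight n 1 w / (n : R) := by
    rw [Hyperforest.rootedWeight_one, Hyperforest.hypertreeWeight_eq_unrootedWeight_one hn,
      mul_div_cancel_left₀ _ hn0]
  refine ⟨fun lam => ⟨Hyperforest.unrootedGF_eq_sum n w lam,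
    Hyperforest.unrootedGF_eq_sum_rootedWeight hn w lam, ?_⟩,
    fun p => ⟨Hyperforest.unrootedWeight_eq_sum_rootedWeight hn p w, ?_⟩,
    Hyperforest.hypertreeWeight_eq_unrootedWeight_one hn w, ?_, hone⟩
  · rw [Hyperforest.unrootedGF_eq_sum_rootedWeight hn, hroot]
  · rw [Hyperforest.unrootedWeight_eq_sum_rootedWeight hn, hroot]
  · rw [hone, Hyperforest.rootedWeight_eq_choose_mul (Finset.mem_Icc.2 ⟨le_rfl, hn⟩)]
    simp
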